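/- Let $n\ge 3$, $k\ge 2$, and let $\mathcal G_{RC}$ be the cycle of $n$ cliques: its nodes are $(c,j)$, $1\le c\le n$, $1\le j\le k$; two different nodes of the same clique $c$ are adjacent, and the nodes $(c,1)$, $c=1,\dots,n$, form a cycle of length $n$. Let $0<\mu$ and $L$ be real, $\kappa=L/\mu$. For a symmetric positive semidefinite matrix $M\ne0$ let $\lambda_{\max}(M)$ and $\lambda^+_{\min}(M)$ be its largest and its smallest positive eigenvalue, and $\chi=\chi(M)=\lambda_{\max}(M)/\lambda_{\min}^+(M)$. **Two settings.** (A) *With $\mathbf L(\mathcal G_{RC})$.* Every node $i$ holds an $L$-smooth, $\mu$-strongly convex function $f_i:\mathbb R^n\to\mathbb R$ and a vector $x_i\in\mathbb R^n$; the communication matrix is $M=\mathbf L(\mathcal G_{RC})\otimes \mathbf I_n$, where $\mathbf L$ is the graph Laplacian; $x^*$ denotes the minimizer of $\sum_i f_i(x)$ over $\mathbb R^n$. (B) *With $\mathbf W$.* For $\ell=1,\dots,n$ the $\ell$-th crown consists of the clique $\ell$ and of the nodes $(c,1)$ of the two cliques $c$ adjacent to $\ell$ in the cycle. Let $\mathcal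 N_i$ be the set of those $\ell$ for which node $i$ lies in the $\ell$-th crown. Node $i$ holds an $L$-smooth, $\mu$-strongly convex function $f_i:\mathbb R^{\mathcal N_i}\to\mathbb R$ and a vector $x_i\in\mathbb R^{\mathcal N_i}$. The communication matrix $M$ is $\mathbf W=\sum_{\ell=1}^n \mathbf L(\mathcal G^\ell)\otimes e_\ell e_\ell^\top$, restricted to the coordinates $(i,\ell)$ with $\ell\in\mathcal N_i$ (all its other rows and columns are zero), where $\mathcal G^\ell$ has all nodes of $\mathcal G_{RC}$, and those edges of $\mathcal G_{RC}$ whose two ends lie in the $\ell$-th crown; $x^*$ denotes the minimizer of $\sum_i f_i(x^{[\mathcal N_i]})$ over $x\in\mathbb R^n$, where $x^{[\mathcal N_i]}$ is the subvector with indices in $\mathcal N_i$. In both settings let $\mathbf x=(x_i)_i$ be the stacked vector, $F(\mathbf x)=\sum_i f_i(x_i)$, and let $\mathbf z$ be the stacked vector in which each node stores its coordinates of $x^*$. **The methods.** One communication round is one multiplication of a stacked vector by $M$. Put $K=\lfloor\sqrt\chi\rfloor$, $c_1=\frac{\sqrt\chi-1}{\sqrt\chi+1}$, $c_2=\frac{\chi+1}{\chi-1}$,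 $c_3=\frac{2\chi}{(\chi+1)\lambda_{\max}(M)}$. The procedure $\mathrm{AG}(\mathbf x)$ (accelerated gossip, $K$ rounds) returns $\mathbf x-\mathbf x_K/a_K$, where $a_0=1$, $a_1=c_2$, $a_{j+1}=2c_2a_j-a_{j-1}$, $\mathbf x_0=\mathbf x$, $\mathbf x_1=c_2(I-c_3M)\mathbf x$, $\mathbf x_{j+1}=2c_2(I-c_3M)\mathbf x_j-\mathbf x_{j-1}$. *MSDA* (dual): $\mathbf x_0=\mathbf y_0=0$ and, for $t\ge0$, $\theta_t=\nabla F^*(\mathbf x_t)$ (with $F^*$ the Fenchel conjugate, so this is computed at each node separately), $\mathbf y_{t+1}=\mathbf x_t-\eta\,\mathrm{AG}(\theta_t)$, $\mathbf x_{t+1}=(1+m)\mathbf y_{t+1}-m\mathbf y_t$, where $\eta=\frac{\mu(1+c_1^{2K})}{(1+c_1^K)^2}$, $m=\frac{(1+c_1^K)\sqrt\kappa-1+c_1^K}{(1+c_1^K)\sqrt\kappa+1-c_1^K}$. The output after $t$ iterations is $\theta_t$. Its initial quantity is $R_0=\kappa\,\|\nabla F(\mathbf z)\|^2/\mu^2$.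 *OPAPC* (primal): $\mathbf x^0$ is any stacked vector, $\mathbf x_f^0=\mathbf x^0$, $\mathbf y^0\in\operatorname{range}M$ is arbitrary, and for $t\ge 0$ $\mathbf x_g=\tau\mathbf x^t+(1-\tau)\mathbf x^t_f$, $\ \mathbf x_{1/2}=(1+\eta\mu)^{-1}(\mathbf x^t-\eta(\nabla F(\mathbf x_g)-\mu\mathbf x_g+\mathbf y^t))$, $\ \mathbf y^{t+1}=\mathbf y^t+\theta\,\mathrm{AG}(\mathbf x_{1/2})$, $\ \mathbf x^{t+1}=(1+\eta\mu)^{-1}(\mathbf x^t-\eta(\nabla F(\mathbf x_g)-\mu\mathbf x_g+\mathbf y^{t+1}))$, $\ \mathbf x_f^{t+1}=\mathbf x_g+\frac{2\tau}{2-\tau}(\mathbf x^{t+1}-\mathbf x^t)$, where $\tau=\min\{1,\frac{1+c_1^K}{2\sqrt\kappa(1-c_1^K)}\}$, $\eta=\frac1{4\tau L}$, $\theta=\frac{1+c_1^{2K}}{\eta(1+c_1^K)^2}$. The output after $t$ iterations is $\mathbf x^t$. Its initial quantity is $R_0=\kappa\,(\|\mathbf x^0-\mathbf z\|^2+\|\mathbf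 y^0+\nabla F(\mathbf z)\|^2/\mu^2)$. **Claim.** There is an absolute constant $C>0$ such that, for all $n,k,L,\mu,f_i$ as above, a minimizer $x^*$ exists, and each of the two methods has the following communication complexity: for every $R\ge R_0$ and every accuracy $0<\varepsilon\le R/2$, after at most $$C\sqrt{\tfrac L\mu}\;nk\,\ln\tfrac R\varepsilon\quad\text{rounds in setting (A)},\qquad C\sqrt{\tfrac L\mu}\;\sqrt k\,\ln\tfrac R\varepsilon\quad\text{rounds in setting (B)},$$ the output $\mathbf u$ satisfies $\|\mathbf u-\mathbf z\|^2\le\varepsilon$, and so do all later outputs. In short, the communication complexity is $O(\sqrt{L/\mu}\,nk\ln(1/\varepsilon))$ with $\mathbf L(\mathcal G_{RC})$ and $O(\sqrt{L/\mu}\sqrt k\ln(1/\varepsilon))$ with $\mathbf W$. -/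

import Mathlib

open scoped Kronecker Gradient

noncomputable section

namespace DistOpt

/-! ### Spectral quantities of a communication matrix -/

section Spectral

variable {ι : Type*} [Fintype ι] [DecidableEq ι]

/-- The largest eigenvalue of a (symmetric) matrix. -/
def lambdaMax (M : Matrix ι ι ℝ) : ℝ := sSup (spectrum ℝ M)

/-- The smallest positive eigenvalue of a (symmetric) matrix. -/
def lambdaMinPos (M : Matrix ι ι ℝ) : ℝ := sInf {t : ℝ | t ∈ spectrum ℝ M ∧ 0 < t}

/-- The condition number: the largest eigenvalue over the smallest positive one. -/
def condNumber (M : Matrix ι ι ℝ) : ℝ := lambdaMax M / lambdaMinPos M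

end Spectral

/-! ### Classes of functions -/

/-- `f` is `L`-smooth: differentiable with `L`-Lipschitz gradient. -/
def LSmooth {E : Type*} [NormedAddCommGroup E] [InnerProductSpace ℝ E] [CompleteSpace E]
    (L : ℝ) (f : E → ℝ) : Prop :=
  Differentiable ℝ f ∧ ∀ x y : E, ‖∇ f x - ∇ f y‖ ≤ L * ‖x - y‖

/-- The Fenchel conjugate `f* y = sup_x (⟪x, y⟫ - f x)`. -/
def conjugate {E : Type*} [NormedAddCommGroup E] [InnerProductSpace ℝ E]
    (f : E → ℝ) (y : E) : ℝ :=
  ⨆ x : E, (inner ℝ x y - f x)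

/-! ### Stacked vectors

Node `i` of the network stores a vector whose coordinates are indexed by `S i`. The vectors of all
the nodes are stacked into one vector with coordinates indexed by `Σ i, S i`. -/

section Stacked

variable {V : Type*} [Fintype V] {S : V → Type*} [∀ i, Fintype (S i)]

/-- The vector stored at node `i`. -/
def nodePart (x : EuclideanSpace ℝ (Σ i, S i)) (i : V) : EuclideanSpace ℝ (S i) :=
  WithLp.toLp 2 fun s => x ⟨i, s⟩

/-- The local computation in which every node `i` applies `g i` to its own vector. -/
def nodewise (g : ∀ i, EuclideanSpace ℝ (S i) → EuclideanSpace ℝ (S i))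
    (x : EuclideanSpace ℝ (Σ i, S i)) : EuclideanSpace ℝ (Σ i, S i) :=
  WithLp.toLp 2 fun p => g p.1 (nodePart x p.1) p.2

end Stacked

/-! ### Gossip with Chebyshev acceleration

One communication round is one multiplication of the stacked vector by the communication matrix.
All procedures below carry a counter of the rounds that they have used. -/

section Gossip

variable {ι : Type*} [Fintype ι] [DecidableEq ι]

/-- `√χ` for the condition number `χ` of the communication matrix. -/
def sqrtChi (M : Matrix ι ι ℝ) : ℝ := √(condNumber M)

/-- Number of gossip rounds per iteration, `⌊√χ⌋`. -/
def gossipLength (M : Matrix ι ι ℝ) : ℕ := ⌊sqrtChi M⌋₊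

def c₁ (M : Matrix ι ι ℝ) : ℝ := (sqrtChi M - 1) / (sqrtChi M + 1)

def c₂ (M : Matrix ι ι ℝ) : ℝ := (condNumber M + 1) / (condNumber M - 1)

def c₃ (M : Matrix ι ι ℝ) : ℝ := 2 * condNumber M / ((condNumber M + 1) * lambdaMax M)

/-- State of the accelerated gossip: two consecutive scalars, two consecutive vectors, and the
number of communication rounds used. -/
structure GossipState (ι : Type*) where
  aPrev : ℝ
  a : ℝ
  xPrev : EuclideanSpace ℝ ι
  x : EuclideanSpace ℝ ι
  rounds : ℕ

/-- `a₀ = 1`, `a₁ = c₂`, `x₀ = x`, `x₁ = c₂ (I - c₃ M) x`. -/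
def gossipInit (M : Matrix ι ι ℝ) (x : EuclideanSpace ℝ ι) : GossipState ι where
  aPrev := 1
  a := c₂ M
  xPrev := x
  x := c₂ M • (x - c₃ M • M.toEuclideanLin x)
  rounds := 1

/-- `aₖ₊₁ = 2 c₂ aₖ - aₖ₋₁`, `xₖ₊₁ = 2 c₂ (I - c₃ M) xₖ - xₖ₋₁`. -/
def gossipStep (M : Matrix ι ι ℝ) (s : GossipState ι) : GossipState ι where
  aPrev := s.a
  a := 2 * c₂ M * s.a - s.aPrev
  xPrev := s.x
  x := (2 * c₂ M) • (s.x - c₃ M • M.toEuclideanLin s.x) - s.xPrev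
  rounds := s.rounds + 1

/-- The state `(a_{K-1}, a_K, x_{K-1}, x_K)` with `K = gossipLength M`. -/
def gossipFinal (M : Matrix ι ι ℝ) (x : EuclideanSpace ℝ ι) : GossipState ι :=
  (gossipStep M)^[gossipLength M - 1] (gossipInit M x)

/-- Output `x - x_K / a_K` of the accelerated gossip procedure. -/
def acceleratedGossip (M : Matrix ι ι ℝ) (x : EuclideanSpace ℝ ι) : EuclideanSpace ℝ ι :=
  x - (gossipFinal M x).a⁻¹ • (gossipFinal M x).x

/-- Number of communication rounds used by the accelerated gossip procedure. -/
def gossipRounds (M : Matrix ι ι ℝ) (x : EuclideanSpace ℝ ι) : ℕ := (gossipFinal M x).rounds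

end Gossip

/-! ### The two methods

Both are run on local functions `f i`, held by the nodes `i`, that are `L`-smooth and `μ`-strongly
convex, with a communication matrix `M` acting on the stacked vectors. -/

section Methods

variable {V : Type*} [Fintype V] [DecidableEq V]
  {S : V → Type*} [∀ i, Fintype (S i)] [∀ i, DecidableEq (S i)]

/-! #### MSDA: the multi-step dual accelerated method -/

/-- Step size `μ (1 + c₁^(2K)) / (1 + c₁^K)²`. -/
def msdaStepSize (μ : ℝ) (M : Matrix (Σ i, S i) (Σ i, S i) ℝ) : ℝ :=
  μ * (1 + c₁ M ^ (2 * gossipLength M)) / (1 + c₁ M ^ gossipLength M) ^ 2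

/-- Momentum `((1 + c₁^K) √κ - 1 + c₁^K) / ((1 + c₁^K) √κ + 1 - c₁^K)`, `κ = L / μ`. -/
def msdaMomentum (L μ : ℝ) (M : Matrix (Σ i, S i) (Σ i, S i) ℝ) : ℝ :=
  ((1 + c₁ M ^ gossipLength M) * √(L / μ) - 1 + c₁ M ^ gossipLength M) /
    ((1 + c₁ M ^ gossipLength M) * √(L / μ) + 1 - c₁ M ^ gossipLength M)

/-- State of MSDA: the dual sequences and the number of communication rounds used. -/
structure MSDAState (ι : Type*) where
  x : EuclideanSpace ℝ ι
  y : EuclideanSpace ℝ ι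
  rounds : ℕ

/-- The primal point `θᵢ = ∇ fᵢ* (xᵢ)`. -/
def msdaPrimal (f : ∀ i, EuclideanSpace ℝ (S i) → ℝ) (s : MSDAState (Σ i, S i)) :
    EuclideanSpace ℝ (Σ i, S i) :=
  nodewise (fun i => ∇ (conjugate (f i))) s.x

/-- `θ = ∇F*(x)`, `y⁺ = x - η · AcceleratedGossip(θ)`, `x⁺ = (1 + m) y⁺ - m y`. -/
def msdaStep (L μ : ℝ) (M : Matrix (Σ i, S i) (Σ i, S i) ℝ)
    (f : ∀ i, EuclideanSpace ℝ (S i) → ℝ) (s : MSDAState (Σ i, S i)) :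
    MSDAState (Σ i, S i) :=
  let yNew := s.x - msdaStepSize μ M • acceleratedGossip M (msdaPrimal f s)
  { x := (1 + msdaMomentum L μ M) • yNew - msdaMomentum L μ M • s.y
    y := yNew
    rounds := s.rounds + gossipRounds M (msdaPrimal f s) }

/-- State of MSDA after `t` iterations, started from zero. -/
def msda (L μ : ℝ) (M : Matrix (Σ i, S i) (Σ i, S i) ℝ)
    (f : ∀ i, EuclideanSpace ℝ (S i) → ℝ) (t : ℕ) : MSDAState (Σ i, S i) :=
  (msdaStep L μ M f)^[t] { x := 0, y := 0, rounds := 0 }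

/-! #### OPAPC: the optimal proximal alternating predictor-corrector method -/

/-- `τ = min {1, (1 + c₁^K) / (2 √κ (1 - c₁^K))}`, `κ = L / μ`. -/
def opapcTau (L μ : ℝ) (M : Matrix (Σ i, S i) (Σ i, S i) ℝ) : ℝ :=
  min 1 ((1 + c₁ M ^ gossipLength M) / (2 * √(L / μ) * (1 - c₁ M ^ gossipLength M)))

/-- `η = 1 / (4 τ L)`. -/
def opapcEta (L μ : ℝ) (M : Matrix (Σ i, S i) (Σ i, S i) ℝ) : ℝ :=
  1 / (4 * opapcTau L μ M * L)

/-- `θ = (1 + c₁^(2K)) / (η (1 + c₁^K)²)`. -/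
def opapcTheta (L μ : ℝ) (M : Matrix (Σ i, S i) (Σ i, S i) ℝ) : ℝ :=
  (1 + c₁ M ^ (2 * gossipLength M)) / (opapcEta L μ M * (1 + c₁ M ^ gossipLength M) ^ 2)

/-- State of OPAPC: the sequences `x`, `x_f`, `y` and the number of communication rounds used. -/
structure OPAPCState (ι : Type*) where
  x : EuclideanSpace ℝ ι
  xf : EuclideanSpace ℝ ι
  y : EuclideanSpace ℝ ι
  rounds : ℕ

/-- One iteration, with `α = μ`:
`x_g = τ x + (1 - τ) x_f`,
`x_{1/2} = (1 + η α)⁻¹ (x - η (∇F(x_g) - α x_g + y))`,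
`y⁺ = y + θ · AcceleratedGossip(x_{1/2})`,
`x⁺ = (1 + η α)⁻¹ (x - η (∇F(x_g) - α x_g + y⁺))`,
`x_f⁺ = x_g + (2 τ / (2 - τ)) (x⁺ - x)`. -/
def opapcStep (L μ : ℝ) (M : Matrix (Σ i, S i) (Σ i, S i) ℝ)
    (f : ∀ i, EuclideanSpace ℝ (S i) → ℝ) (s : OPAPCState (Σ i, S i)) :
    OPAPCState (Σ i, S i) :=
  let τ := opapcTau L μ M
  let η := opapcEta L μ M
  let xg := τ • s.x + (1 - τ) • s.xf
  let g := nodewise (fun i => ∇ (f i)) xg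
  let xHalf := (1 + η * μ)⁻¹ • (s.x - η • (g - μ • xg + s.y))
  let yNew := s.y + opapcTheta L μ M • acceleratedGossip M xHalf
  let xNew := (1 + η * μ)⁻¹ • (s.x - η • (g - μ • xg + yNew))
  { x := xNew
    xf := xg + (2 * τ / (2 - τ)) • (xNew - s.x)
    y := yNew
    rounds := s.rounds + gossipRounds M xHalf }

/-- State of OPAPC after `t` iterations, started from the primal point `x₀ = x_f` and the dual
point `y₀`. -/
def opapc (L μ : ℝ) (M : Matrix (Σ i, S i) (Σ i, S i) ℝ)
    (f : ∀ i, EuclideanSpace ℝ (S i) → ℝ) (x₀ y₀ : EuclideanSpace ℝ (Σ i, S i)) (t : ℕ) :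
    OPAPCState (Σ i, S i) :=
  (opapcStep L μ M f)^[t] { x := x₀, xf := x₀, y := y₀, rounds := 0 }

/-! #### Communication complexity -/

/-- After at most `B` communication rounds the (squared) error is at most `ε`, and it stays so. -/
def ReachesWithin (err : ℕ → ℝ) (rounds : ℕ → ℕ) (ε B : ℝ) : Prop :=
  ∃ t : ℕ, (rounds t : ℝ) ≤ B ∧ ∀ s : ℕ, t ≤ s → err s ≤ ε

/-- MSDA finds the stacked solution `z` with communication complexity `B · ln (R / ε)`: it reaches
squared distance `ε` to `z` within that many rounds, for any upper bound `R` on the initial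
quantity `(L / μ) ‖∇F(z)‖² / μ²` (the dual starting point is `0`, the dual solution is `∇F(z)`)
and any accuracy `ε ≤ R / 2`. -/
def MSDAComplexity (L μ : ℝ) (M : Matrix (Σ i, S i) (Σ i, S i) ℝ)
    (f : ∀ i, EuclideanSpace ℝ (S i) → ℝ) (z : EuclideanSpace ℝ (Σ i, S i)) (B : ℝ) : Prop :=
  ∀ R ε : ℝ, (L / μ) * (‖nodewise (fun i => ∇ (f i)) z‖ ^ 2 / μ ^ 2) ≤ R → 0 < ε → ε ≤ R / 2 →
    ReachesWithin (fun t => ‖msdaPrimal f (msda L μ M f t) - z‖ ^ 2)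
      (fun t => (msda L μ M f t).rounds) ε (B * Real.log (R / ε))

/-- OPAPC, from any primal starting point `x₀` and any dual starting point `y₀` in the range of
`M`, finds the stacked solution `z` with communication complexity `B · ln (R / ε)`: it reaches
squared distance `ε` to `z` within that many rounds, for any upper bound `R` on the initial
quantity `(L / μ) (‖x₀ - z‖² + ‖y₀ + ∇F(z)‖² / μ²)` (the dual solution is `-∇F(z)`)
and any accuracy `ε ≤ R / 2`. -/
def OPAPCComplexity (L μ : ℝ) (M : Matrix (Σ i, S i) (Σ i, S i) ℝ)
    (f : ∀ i, EuclideanSpace ℝ (S i) → ℝ) (z : EuclideanSpace ℝ (Σ i, S i)) (B : ℝ) : Prop :=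
  ∀ x₀ y₀ : EuclideanSpace ℝ (Σ i, S i), y₀ ∈ LinearMap.range M.toEuclideanLin →
  ∀ R ε : ℝ,
    (L / μ) * (‖x₀ - z‖ ^ 2 + ‖y₀ + nodewise (fun i => ∇ (f i)) z‖ ^ 2 / μ ^ 2) ≤ R →
    0 < ε → ε ≤ R / 2 →
    ReachesWithin (fun t => ‖(opapc L μ M f x₀ y₀ t).x - z‖ ^ 2)
      (fun t => (opapc L μ M f x₀ y₀ t).rounds) ε (B * Real.log (R / ε))

end Methods

/-! ### Distributed partitioned problems -/

section Partitioned

variable {V : Type*} [Fintype V] [DecidableEq V] {n : ℕ}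

/-- The subvector `x^[N]` of the variables with index in `N`. -/
def subvector (N : Finset (Fin n)) (x : EuclideanSpace ℝ (Fin n)) : EuclideanSpace ℝ N :=
  WithLp.toLp 2 fun l => x l

/-- The communication graph of the variable `x^l`, on the set of all nodes: the edges of `G`
between nodes that both hold `x^l`. -/
def variableGraph (G : SimpleGraph V) (N : V → Finset (Fin n)) (l : Fin n) : SimpleGraph V where
  Adj u v := G.Adj u v ∧ l ∈ N u ∧ l ∈ N v
  symm := ⟨fun _ _ h => ⟨h.1.symm, h.2.2, h.2.1⟩⟩
  loopless := ⟨fun _ h => h.1.ne rfl⟩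

open Classical in
/-- The communication matrix `W = ∑ l, L(G^l) ⊗ e_l e_lᵀ`. -/
def partitionedMatrix (G : SimpleGraph V) (N : V → Finset (Fin n)) :
    Matrix (V × Fin n) (V × Fin n) ℝ :=
  ∑ l : Fin n, (variableGraph G N l).lapMatrix ℝ ⊗ₖ Matrix.single l l (1 : ℝ)

/-- `W` as an operator on the stacked vectors in which node `i` stores only the variables `x^l`
with `l ∈ N i`. All rows and columns of `W` that are left out are zero. -/
def partitionedGossip (G : SimpleGraph V) (N : V → Finset (Fin n)) :
    Matrix (Σ i : V, N i) (Σ i : V, N i) ℝ :=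
  (partitionedMatrix G N).submatrix (fun p => (p.1, p.2.1)) (fun p => (p.1, p.2.1))

open Classical in
/-- `L(G) ⊗ I_n`: the Laplacian as an operator on the stacked vectors in which every node stores
all `n` variables. -/
def laplacianGossip (G : SimpleGraph V) (n : ℕ) :
    Matrix (Σ _ : V, Fin n) (Σ _ : V, Fin n) ℝ :=
  (G.lapMatrix ℝ ⊗ₖ (1 : Matrix (Fin n) (Fin n) ℝ)).submatrix
    (fun p => (p.1, p.2)) (fun p => (p.1, p.2))

/-- The stacked vector in which every node stores all of `x`. -/
def stackFull (V : Type*) [Fintype V] (x : EuclideanSpace ℝ (Fin n)) :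
    EuclideanSpace ℝ (Σ _ : V, Fin n) :=
  WithLp.toLp 2 fun p => x p.2

/-- The stacked vector in which every node `i` stores the subvector of `x` with indices in
`N i`. -/
def stackPartitioned (N : V → Finset (Fin n)) (x : EuclideanSpace ℝ (Fin n)) :
    EuclideanSpace ℝ (Σ i : V, N i) :=
  WithLp.toLp 2 fun p => x p.2.1

end Partitioned

/-! ### The cycle of cliques -/

/-- `n` cliques of size `k`, where node `(c, j)` is the `j`-th node of the clique `c`; the nodes
`(c, 0)` of the cliques are joined in a cycle. -/
def ringOfCliques (n k : ℕ) : SimpleGraph (Fin n × Fin k) where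
  Adj u v := (u.1 = v.1 ∧ u.2 ≠ v.2) ∨
    ((u.2 : ℕ) = 0 ∧ (v.2 : ℕ) = 0 ∧ (SimpleGraph.cycleGraph n).Adj u.1 v.1)
  symm := ⟨fun _ _ h => h.elim (fun h => Or.inl ⟨h.1.symm, h.2.symm⟩)
    (fun h => Or.inr ⟨h.2.1, h.1, h.2.2.symm⟩)⟩
  loopless := ⟨fun _ h => h.elim (fun h => h.2 rfl) (fun h => h.2.2.ne rfl)⟩

open Classical in
/-- The variables on which the function of node `(c, j)` depends: `x^l` belongs to the crown of
clique `l`, which consists of the clique and of the nodes `(c, 0)` of the two adjacent cliques. -/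
def crownVariables (n k : ℕ) (v : Fin n × Fin k) : Finset (Fin n) :=
  {l | v.1 = l ∨ ((v.2 : ℕ) = 0 ∧ (SimpleGraph.cycleGraph n).Adj v.1 l)}

end DistOpt

end

/-!
Both methods are accelerated first-order methods preconditioned by accelerated gossip, and both
bounds follow from one analysis for an arbitrary communication matrix `M`.

*Gossip.* Accelerated gossip applies `1 - T_K(c₂ (1 - c₃ M)) / T_K(c₂)`, where `T_K` is the
Chebyshev polynomial. It annihilates the kernel of `M`, and after rescaling it maps every positive
eigenvalue of `M` into `[σ², 1]`, where `σ = (1 - q) / (1 + q)` and `q = c₁ ^ K`. For `K = ⌊√χ⌋`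
Bernoulli's inequality gives `q ≤ 1 / 3`, so `σ ≥ 1 / 2`: at the price of `√χ` rounds per iteration,
the communication matrix behaves as if its condition number were an absolute constant
(`isPreconditioner_gossipPrecond`, `half_le_gossipGap`).

*MSDA.* In the dual variables MSDA is Nesterov's method for the conjugate `F*` on the range of the
gossip operator `P`. All dual iterates are written as `P a`, with the seminorm `⟪a, P a⟫`; there `F*`
is `1 / μ`-smooth and `σ² / L`-strongly convex, so the usual Lyapunov function contracts by
`1 - σ / √κ` (`nesterovEnergy_step`).

*OPAPC.* Writing the dual error as `P u`, the squared primal distance, the form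
`⟪u, P u⟫ - ‖P u‖² / (1 + η μ)` and the Bregman divergence of `F - μ/2 ‖·‖²` at the extrapolated
point combine to a Lyapunov function. The exact balance `primalDual_energy` and the acceleration
estimate `accelerated_bregman` make it contract by `1 - 1 / (50 √κ)` (`opapcEnergy_step`).

*Networks.* It remains to bound `χ`. The quadratic form of either communication matrix is a sum of
Dirichlet energies over the variables, with largest eigenvalue `O(k)` because the degrees are
`O(k)`. In the cycle of cliques the energy dominates the squared distance to consensus up to a
factor `O(n² k)` (`ringOfCliques_poincare`), so `√χ = O(n k)`. A crown contains a star joining its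
hub to all of its nodes, so the factor is constant and `√χ = O(√k)`. The accelerated gossip
coefficients are meaningful only for `χ > 1`; this holds because `M` has a zero entry at two nodes
with a common neighbour and hence is not a multiple of a projection (`spectrum_gap_of_entries`).
-/

namespace DistOpt

/-! ### Smooth strongly convex functions -/

section Convex

variable {E : Type*} [NormedAddCommGroup E] [InnerProductSpace ℝ E]

/-- `F` is differentiable with gradient `G`, `μ`-strongly convex and `L`-smooth, expressed by the
quadratic lower and upper bounds of `F` at every point. -/
structure SmoothStrong (μ L : ℝ) (F : E → ℝ) (G : E → E) : Prop where
  lower : ∀ x y, F x + inner ℝ (G x) (y - x) + μ / 2 * ‖y - x‖ ^ 2 ≤ F y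
  upper : ∀ x y, F y ≤ F x + inner ℝ (G x) (y - x) + L / 2 * ‖y - x‖ ^ 2

/-- The Bregman divergence of `F` with gradient `G`. -/
def bregman (F : E → ℝ) (G : E → E) (y x : E) : ℝ := F y - F x - inner ℝ (G x) (y - x)

variable {μ L : ℝ} {F : E → ℝ} {G : E → E}

theorem SmoothStrong.lower_bregman (h : SmoothStrong μ L F G) (y x : E) :
    μ / 2 * ‖y - x‖ ^ 2 ≤ bregman F G y x := by
  have := h.lower x y
  unfold bregman; linarith

theorem SmoothStrong.bregman_upper (h : SmoothStrong μ L F G) (y x : E) :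
    bregman F G y x ≤ L / 2 * ‖y - x‖ ^ 2 := by
  have := h.upper x y
  unfold bregman; linarith

/-- Subtracting `μ / 2 * ‖x‖ ^ 2` removes the strong convexity and keeps the smoothness. -/
theorem SmoothStrong.sub_sq (h : SmoothStrong μ L F G) (hμ : 0 ≤ μ) :
    SmoothStrong 0 L (fun x => F x - μ / 2 * ‖x‖ ^ 2) (fun x => G x - μ • x) := by
  have key : ∀ x y : E, ‖y - x‖ ^ 2 = ‖y‖ ^ 2 - ‖x‖ ^ 2 - 2 * inner ℝ x (y - x) := by
    intro x y
    rw [norm_sub_sq_real, inner_sub_right, real_inner_self_eq_norm_sq, real_inner_comm]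
    ring
  constructor
  · intro x y
    have h1 := h.lower x y
    have h2 := key x y
    simp only [inner_sub_left, inner_smul_left, RCLike.conj_to_real]
    rw [h2] at h1
    rw [zero_div, zero_mul]
    linarith
  · intro x y
    have h1 := h.upper x y
    have h2 := key x y
    have h3 : 0 ≤ μ / 2 * ‖y - x‖ ^ 2 := by positivity
    simp only [inner_sub_left, inner_smul_left, RCLike.conj_to_real]
    rw [h2] at h3
    linarith

/-- Co-coercivity: the Bregman divergence of a convex `L`-smooth function controls the distance of
the gradients. -/
theorem SmoothStrong.norm_grad_sub_sq_le (h : SmoothStrong μ L F G) (hμ : 0 ≤ μ) (hL : 0 < L)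
    (y x : E) : ‖G y - G x‖ ^ 2 ≤ 2 * L * bregman F G y x := by
  -- compare the lower bound at `x` with the upper bound at `y` in the point `w`
  set w := y - L⁻¹ • (G y - G x) with hw
  have h1 := h.lower x w
  have h2 := h.upper y w
  have h0 : 0 ≤ μ / 2 * ‖w - x‖ ^ 2 := by positivity
  have e1 : w - y = -(L⁻¹ • (G y - G x)) := by rw [hw]; abel
  have e2 : w - x = (y - x) - L⁻¹ • (G y - G x) := by rw [hw]; abel
  rw [e1, norm_neg, norm_smul, inner_neg_right, inner_smul_right, mul_pow, Real.norm_eq_abs,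
    sq_abs] at h2
  rw [e2] at h0
  rw [e2, inner_sub_right, inner_smul_right] at h1
  have e3 : ‖G y - G x‖ ^ 2 = inner ℝ (G y) (G y - G x) - inner ℝ (G x) (G y - G x) := by
    rw [← inner_sub_left, real_inner_self_eq_norm_sq]
  have e4 : L / 2 * (L⁻¹ ^ 2 * ‖G y - G x‖ ^ 2) = L⁻¹ / 2 * ‖G y - G x‖ ^ 2 := by
    field_simp
  have e5 : L⁻¹ / 2 * ‖G y - G x‖ ^ 2 ≤ bregman F G y x := by
    unfold bregman
    have : L⁻¹ * ‖G y - G x‖ ^ 2 =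
      L⁻¹ * inner ℝ (G y) (G y - G x) - L⁻¹ * inner ℝ (G x) (G y - G x) := by rw [e3]; ring
    linarith
  calc ‖G y - G x‖ ^ 2 = 2 * L * (L⁻¹ / 2 * ‖G y - G x‖ ^ 2) := by field_simp
    _ ≤ _ := by gcongr

/-- Strong monotonicity of the gradient. -/
theorem SmoothStrong.mul_norm_sub_le (h : SmoothStrong μ L F G) (y x : E) :
    μ * ‖y - x‖ ≤ ‖G y - G x‖ := by
  have h1 := h.lower x y
  have h2 := h.lower y x
  rw [norm_sub_rev x y, ← neg_sub y x, inner_neg_right] at h2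
  have h3 : μ * ‖y - x‖ ^ 2 ≤ inner ℝ (G y - G x) (y - x) := by
    rw [inner_sub_left]; linarith
  have h4 := real_inner_le_norm (G y - G x) (y - x)
  rcases (norm_nonneg (y - x)).eq_or_lt' with h5 | h5
  · rw [h5, mul_zero]; positivity
  · refine le_of_mul_le_mul_right ?_ h5
    nlinarith

theorem SmoothStrong.le [Nontrivial E] (h : SmoothStrong μ L F G) : μ ≤ L := by
  obtain ⟨x, hx⟩ := exists_ne (0 : E)
  have h1 := (h.lower_bregman x 0).trans (h.bregman_upper x 0)
  have h2 : 0 < ‖x - 0‖ ^ 2 := by rw [sub_zero]; positivity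
  nlinarith

/-- The quadratic bounds hold for differentiable functions in the usual sense. -/
theorem LSmooth.smoothStrong [CompleteSpace E] {f : E → ℝ} (hf : LSmooth L f)
    (hc : StrongConvexOn Set.univ μ f) : SmoothStrong μ L f (∇ f) := by
  have hline : ∀ x v : E, ∀ t : ℝ,
      HasDerivAt (fun s : ℝ => f (x + s • v)) (inner ℝ (∇ f (x + t • v)) v) t := by
    intro x v t
    have h1 : HasDerivAt (fun s : ℝ => x + s • v) v t := by
      simpa using ((hasDerivAt_id t).smul_const v).const_add x
    have h2 := (hf.1 (x + t • v)).hasGradientAt.hasFDerivAt.comp_hasDerivAt t h1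
    rw [InnerProductSpace.toDual_apply_apply] at h2
    exact h2
  constructor
  · intro x y
    -- the difference quotients of `f` along the segment from `x` to `y`
    have hd : HasDerivAt (fun s : ℝ => f (x + s • (y - x))) (inner ℝ (∇ f x) (y - x)) 0 := by
      simpa using hline x (y - x) 0
    have h1 := hd.tendsto_slope_zero_right
    have h2 : Filter.Tendsto (fun t : ℝ => f y - f x - (1 - t) * (μ / 2 * ‖y - x‖ ^ 2))
        (nhdsWithin 0 (Set.Ioi 0)) (nhds (f y - f x - (1 - 0) * (μ / 2 * ‖y - x‖ ^ 2))) := by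
      apply Filter.Tendsto.mono_left _ nhdsWithin_le_nhds
      exact (by fun_prop : Continuous fun t : ℝ =>
        f y - f x - (1 - t) * (μ / 2 * ‖y - x‖ ^ 2)).tendsto 0
    have h3 := le_of_tendsto_of_tendsto h1 h2 (by
      filter_upwards [Ioo_mem_nhdsGT (zero_lt_one' ℝ)] with t ht
      have h4 := hc.2 (Set.mem_univ x) (Set.mem_univ y) (sub_nonneg.2 ht.2.le) ht.1.le
        (by ring)
      have e : x + t • (y - x) = (1 - t) • x + t • y := by module
      simp only [zero_add, zero_smul, add_zero, smul_eq_mul]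
      rw [e, inv_mul_le_iff₀ ht.1]
      rw [norm_sub_rev] at h4
      simp only [smul_eq_mul] at h4
      nlinarith)
    linarith
  · intro x y
    -- along the segment, `f` minus its quadratic upper model is decreasing
    have hanti : AntitoneOn (fun t : ℝ => f (x + t • (y - x)) - t * inner ℝ (∇ f x) (y - x)
        - t ^ 2 * (L / 2 * ‖y - x‖ ^ 2)) (Set.Icc 0 1) := by
      have hder : ∀ t : ℝ, HasDerivAt (fun t : ℝ => f (x + t • (y - x))
          - t * inner ℝ (∇ f x) (y - x) - t ^ 2 * (L / 2 * ‖y - x‖ ^ 2))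
          (inner ℝ (∇ f (x + t • (y - x))) (y - x) - inner ℝ (∇ f x) (y - x)
            - 2 * t * (L / 2 * ‖y - x‖ ^ 2)) t := by
        intro t
        have h1 := hline x (y - x) t
        have h2 : HasDerivAt (fun t : ℝ => t * inner ℝ (∇ f x) (y - x))
            (inner ℝ (∇ f x) (y - x)) t := by
          simpa using (hasDerivAt_id t).mul_const (inner ℝ (∇ f x) (y - x))
        have h3 : HasDerivAt (fun t : ℝ => t ^ 2 * (L / 2 * ‖y - x‖ ^ 2))
            (2 * t * (L / 2 * ‖y - x‖ ^ 2)) t := by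
          simpa using (hasDerivAt_pow 2 t).mul_const (L / 2 * ‖y - x‖ ^ 2)
        exact (h1.sub h2).sub h3
      refine antitoneOn_of_deriv_nonpos (convex_Icc 0 1)
        (fun t _ => (hder t).continuousAt.continuousWithinAt)
        (fun t _ => (hder t).differentiableAt.differentiableWithinAt) ?_
      intro t ht
      rw [interior_Icc] at ht
      rw [(hder t).deriv, ← inner_sub_left]
      have h1 := hf.2 (x + t • (y - x)) x
      rw [add_sub_cancel_left, norm_smul, Real.norm_eq_abs, abs_of_pos ht.1] at h1
      have h2 := real_inner_le_norm (∇ f (x + t • (y - x)) - ∇ f x) (y - x)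
      nlinarith [mul_le_mul_of_nonneg_right h1 (norm_nonneg (y - x))]
    have := hanti (by simp) (by simp) zero_le_one
    simp only [zero_smul, one_smul, add_zero, add_sub_cancel, zero_mul, one_mul, one_pow, ne_eq,
      OfNat.ofNat_ne_zero, not_false_eq_true, zero_pow, sub_zero] at this
    linarith

/-- A strongly convex function attains its minimum along a map from a finite-dimensional space that
does not decrease norms: the composition is coercive. -/
theorem SmoothStrong.exists_isMinOn {E' : Type*} [NormedAddCommGroup E'] [NormedSpace ℝ E']
    [FiniteDimensional ℝ E'] (h : SmoothStrong μ L F G) (hμ : 0 < μ) (hF : Continuous F)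
    (s : E' → E) (hs : Continuous s) (hnorm : ∀ x, ‖x‖ ≤ ‖s x‖) :
    ∃ x, IsMinOn (fun x => F (s x)) Set.univ x := by
  have hlim : Filter.Tendsto (fun x => F (s x)) (Filter.cocompact E') Filter.atTop := by
    have h1 : Filter.Tendsto (fun r : ℝ => F 0 + r * (μ / 2 * r - ‖G 0‖))
        Filter.atTop Filter.atTop := by
      apply Filter.tendsto_atTop_add_const_left
      apply Filter.Tendsto.atTop_mul_atTop₀ Filter.tendsto_id
      apply Filter.tendsto_atTop_add_const_right
      exact Filter.Tendsto.const_mul_atTop (by positivity) Filter.tendsto_id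
    have h2 : Filter.Tendsto (fun x => ‖s x‖) (Filter.cocompact E') Filter.atTop :=
      Filter.tendsto_atTop_mono hnorm (tendsto_norm_cocompact_atTop (E := E'))
    refine Filter.tendsto_atTop_mono (fun x => ?_) (h1.comp h2)
    have h3 := h.lower 0 (s x)
    have h4 := abs_real_inner_le_norm (G 0) (s x)
    rw [sub_zero] at h3
    have h5 := neg_abs_le (inner ℝ (G 0) (s x))
    simp only [Function.comp]
    nlinarith
  have := FiniteDimensional.proper ℝ E'
  obtain ⟨x, hx⟩ := (hF.comp hs).exists_forall_le hlim
  exact ⟨x, fun y _ => hx y⟩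

/-- First-order optimality along a direction. -/
theorem SmoothStrong.inner_eq_zero (h : SmoothStrong μ L F G) {x v : E}
    (hmin : ∀ t : ℝ, F x ≤ F (x + t • v)) : inner ℝ (G x) v = 0 := by
  have h1 : ∀ t : ℝ, 0 ≤ (L / 2 * ‖v‖ ^ 2) * (t * t) + inner ℝ (G x) v * t + 0 := by
    intro t
    have h2 := h.upper x (x + t • v)
    have h3 := hmin t
    rw [add_sub_cancel_left, inner_smul_right, norm_smul, mul_pow, Real.norm_eq_abs, sq_abs] at h2
    nlinarith
  have h2 := discrim_le_zero h1
  unfold discrim at h2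
  nlinarith [sq_nonneg (inner ℝ (G x) v)]

theorem SmoothStrong.grad_surjective [FiniteDimensional ℝ E] (h : SmoothStrong μ L F G)
    (hμ : 0 < μ) (hF : Continuous F) : Function.Surjective G := by
  intro y
  have h' : SmoothStrong μ L (fun x => F x - inner ℝ y x) (fun x => G x - y) := by
    constructor <;> intro a b
    · have := h.lower a b
      simp only [inner_sub_left, inner_sub_right] at this ⊢; linarith
    · have := h.upper a b
      simp only [inner_sub_left, inner_sub_right] at this ⊢; linarith
  obtain ⟨x, hx⟩ := h'.exists_isMinOn hμ (by fun_prop) (id : E → E) continuous_id (fun _ => le_rfl)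
  refine ⟨x, ?_⟩
  have := h'.inner_eq_zero (x := x) (v := G x - y) fun t => hx (Set.mem_univ _)
  exact sub_eq_zero.1 (inner_self_eq_zero.1 this)

/-- The supremum in the conjugate at `G x` is attained at `x`. -/
theorem SmoothStrong.conjugate_eq (h : SmoothStrong μ L F G) (hμ : 0 ≤ μ) (x : E) :
    conjugate F (G x) = inner ℝ x (G x) - F x ∧
      ∀ w, inner ℝ w (G x) - F w ≤ conjugate F (G x) := by
  have h1 : ∀ w, inner ℝ w (G x) - F w ≤ inner ℝ x (G x) - F x := by
    intro w
    have h2 := h.lower x w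
    have h3 : 0 ≤ μ / 2 * ‖w - x‖ ^ 2 := by positivity
    rw [inner_sub_right, real_inner_comm, real_inner_comm x (G x)] at h2
    linarith
  have h2 : conjugate F (G x) = inner ℝ x (G x) - F x :=
    le_antisymm (ciSup_le h1)
      (le_ciSup (f := fun w => inner ℝ w (G x) - F w) ⟨_, by rintro _ ⟨w, rfl⟩; exact h1 w⟩ x)
  exact ⟨h2, fun w => h2 ▸ h1 w⟩

/-- The gradient of the conjugate inverts the gradient. -/
theorem SmoothStrong.gradient_conjugate [FiniteDimensional ℝ E] (h : SmoothStrong μ L F G)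
    (hμ : 0 < μ) (hF : Continuous F) (x : E) : ∇ (conjugate F) (G x) = x := by
  apply HasGradientAt.gradient
  rw [hasGradientAt_iff_isLittleO]
  refine Asymptotics.IsBigO.trans_isLittleO (g := fun y => ‖y - G x‖ ^ 2) ?_ ?_
  · refine Asymptotics.IsBigO.of_bound μ⁻¹ (Filter.Eventually.of_forall fun y => ?_)
    obtain ⟨x', rfl⟩ := h.grad_surjective hμ hF y
    have h1 := (h.conjugate_eq hμ.le x).1
    have h2 := (h.conjugate_eq hμ.le x').1
    have h3 := (h.conjugate_eq hμ.le x).2 x'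
    have h4 := (h.conjugate_eq hμ.le x').2 x
    have h5 := h.mul_norm_sub_le x' x
    have h6 := real_inner_le_norm (x' - x) (G x' - G x)
    rw [Real.norm_eq_abs, Real.norm_eq_abs, abs_of_nonneg (sq_nonneg ‖G x' - G x‖), abs_of_nonneg]
    · have h7 : ‖x' - x‖ ≤ μ⁻¹ * ‖G x' - G x‖ := by
        rw [inv_mul_eq_div, le_div_iff₀ hμ]; linarith
      have h8 := mul_le_mul_of_nonneg_right h7 (norm_nonneg (G x' - G x))
      simp only [inner_sub_left, inner_sub_right] at h6 ⊢
      nlinarith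
    · simp only [inner_sub_right]
      linarith
  · exact (Asymptotics.isLittleO_norm_pow_id one_lt_two).comp_tendsto
      (tendsto_sub_nhds_zero_iff.2 (Filter.tendsto_id (x := nhds (G x))))

end Convex

/-! ### Functions of stacked vectors -/

section Stacked

variable {V : Type*} {S : V → Type*}

theorem nodePart_sub (x y : EuclideanSpace ℝ (Σ i, S i)) (i : V) :
    nodePart (x - y) i = nodePart x i - nodePart y i := rfl

theorem nodePart_nodewise (g : ∀ i, EuclideanSpace ℝ (S i) → EuclideanSpace ℝ (S i))
    (x : EuclideanSpace ℝ (Σ i, S i)) (i : V) : nodePart (nodewise g x) i = g i (nodePart x i) :=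
  rfl

theorem continuous_nodePart (i : V) :
    Continuous fun x : EuclideanSpace ℝ (Σ i, S i) => nodePart x i := by
  unfold nodePart
  fun_prop

variable [∀ i, Fintype (S i)]

/-- The primal point of MSDA inverts the gradient at every node. -/
theorem nodewise_gradient_conjugate {μ L : ℝ} (hμ : 0 < μ) {f : ∀ i, EuclideanSpace ℝ (S i) → ℝ}
    (hf : ∀ i, LSmooth L (f i)) (hc : ∀ i, StrongConvexOn Set.univ μ (f i)) :
    Function.LeftInverse (nodewise fun i => ∇ (conjugate (f i))) (nodewise fun i => ∇ (f i)) ∧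
      Function.RightInverse (nodewise fun i => ∇ (conjugate (f i))) (nodewise fun i => ∇ (f i)) := by
  have hs := fun i => (hf i).smoothStrong (hc i)
  have hcont := fun i => (hf i).1.continuous
  have h1 := fun i => (hs i).gradient_conjugate hμ (hcont i)
  constructor
  · intro x
    ext p
    change (∇ (conjugate (f p.1)) (∇ (f p.1) (nodePart x p.1))) p.2 = _
    rw [h1]; rfl
  · intro x
    ext p
    change (∇ (f p.1) (∇ (conjugate (f p.1)) (nodePart x p.1))) p.2 = _
    obtain ⟨y, hy⟩ := (hs p.1).grad_surjective hμ (hcont p.1) (nodePart x p.1)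
    rw [← hy, h1, hy]; rfl

variable [Fintype V]

/-- The function `x ↦ ∑ i, f i (x i)` of a stacked vector. -/
def stackedSum (f : ∀ i, EuclideanSpace ℝ (S i) → ℝ) (x : EuclideanSpace ℝ (Σ i, S i)) : ℝ :=
  ∑ i, f i (nodePart x i)

theorem inner_eq_sum_nodePart (x y : EuclideanSpace ℝ (Σ i, S i)) :
    inner ℝ x y = ∑ i, inner ℝ (nodePart x i) (nodePart y i) := by
  simp [PiLp.inner_apply, nodePart, Fintype.sum_sigma]

theorem norm_sq_eq_sum_nodePart (x : EuclideanSpace ℝ (Σ i, S i)) :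
    ‖x‖ ^ 2 = ∑ i, ‖nodePart x i‖ ^ 2 := by
  simp_rw [← real_inner_self_eq_norm_sq]
  exact inner_eq_sum_nodePart x x

theorem SmoothStrong.stackedSum {μ L : ℝ} {f : ∀ i, EuclideanSpace ℝ (S i) → ℝ}
    {g : ∀ i, EuclideanSpace ℝ (S i) → EuclideanSpace ℝ (S i)}
    (h : ∀ i, SmoothStrong μ L (f i) (g i)) : SmoothStrong μ L (stackedSum f) (nodewise g) := by
  constructor <;> intro x y
  · rw [inner_eq_sum_nodePart, norm_sq_eq_sum_nodePart, Finset.mul_sum]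
    simp only [DistOpt.stackedSum, ← Finset.sum_add_distrib, nodePart_nodewise, nodePart_sub]
    exact Finset.sum_le_sum fun i _ => (h i).lower (nodePart x i) (nodePart y i)
  · rw [inner_eq_sum_nodePart, norm_sq_eq_sum_nodePart, Finset.mul_sum]
    simp only [DistOpt.stackedSum, ← Finset.sum_add_distrib, nodePart_nodewise, nodePart_sub]
    exact Finset.sum_le_sum fun i _ => (h i).upper (nodePart x i) (nodePart y i)

end Stacked

/-! ### Preconditioners -/

section Abstract

variable {E : Type*} [NormedAddCommGroup E] [InnerProductSpace ℝ E]

/-- A symmetric operator whose nonzero eigenvalues lie in `[ρ, 1]`, expressed by quadratic forms. -/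
structure IsPreconditioner (ρ : ℝ) (P : E →ₗ[ℝ] E) : Prop where
  symm : ∀ u v, inner ℝ (P u) v = inner ℝ u (P v)
  norm_sq_le : ∀ u, ‖P u‖ ^ 2 ≤ inner ℝ u (P u)
  le_norm_sq : ∀ u, ρ * inner ℝ u (P u) ≤ ‖P u‖ ^ 2

variable {ρ : ℝ} {P : E →ₗ[ℝ] E}

theorem IsPreconditioner.nonneg (hP : IsPreconditioner ρ P) (u : E) : 0 ≤ inner ℝ u (P u) :=
  (sq_nonneg _).trans (hP.norm_sq_le u)

/-! ### The dual method -/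

variable {μ L : ℝ} {F : E → ℝ} {G : E → E}

/-- The conjugate of a `μ`-strongly convex and `L`-smooth function is `1 / L`-strongly convex and
`1 / μ`-smooth. -/
theorem SmoothStrong.dual (h : SmoothStrong μ L F G) (hμ : 0 < μ) (hL : 0 < L) {g : E → E}
    (hg : Function.RightInverse g G) :
    SmoothStrong (1 / L) (1 / μ) (fun p => inner ℝ p (g p) - F (g p)) g := by
  constructor <;> intro p q
  · have h1 := h.norm_grad_sub_sq_le hμ.le hL (g p) (g q)
    rw [hg, hg, norm_sub_rev, bregman, hg, inner_sub_right] at h1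
    rw [inner_sub_right, real_inner_comm q (g p), real_inner_comm p (g p)]
    have h2 : 1 / L / 2 * ‖q - p‖ ^ 2 ≤
        F (g p) - F (g q) - (inner ℝ q (g p) - inner ℝ q (g q)) := by
      rw [div_div, one_div_mul_eq_div, div_le_iff₀ (by positivity)]
      linarith
    linarith
  · have h1 := h.lower (g p) (g q)
    rw [hg, inner_sub_right, norm_sub_rev] at h1
    have h2 : 0 ≤ ‖μ • (g p - g q) - (p - q)‖ ^ 2 := sq_nonneg _
    rw [norm_sub_sq_real, norm_smul, mul_pow, Real.norm_eq_abs, sq_abs, inner_smul_left,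
      RCLike.conj_to_real, norm_sub_rev p q] at h2
    have h3 : 1 / μ / 2 * ‖q - p‖ ^ 2 = (‖q - p‖ ^ 2) / (2 * μ) := by field_simp
    have h4 : inner ℝ (g p - g q) (p - q) - μ / 2 * ‖g p - g q‖ ^ 2 ≤
        1 / μ / 2 * ‖q - p‖ ^ 2 := by
      rw [h3, le_div_iff₀ (by positivity)]
      nlinarith
    simp only [inner_sub_left, inner_sub_right] at h4 ⊢
    rw [real_inner_comm p (g p), real_inner_comm q (g p), real_inner_comm p (g q),
      real_inner_comm q (g q)] at *
    linarith

/-- The Lyapunov function of Nesterov's method in the seminorm given by the preconditioner `P`.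
The extrapolated point `a` and the gradient-step point `b` determine the third point
`a + (a - b) / s` of the method. -/
noncomputable def nesterovEnergy (L ρ s : ℝ) (P : E →ₗ[ℝ] E) (Φ : E → ℝ) (u a b : E) : ℝ :=
  Φ (P b) - Φ (P u) +
    ρ / (2 * L) * inner ℝ (a + s⁻¹ • (a - b) - u) (P (a + s⁻¹ • (a - b) - u))

/-- One step of Nesterov's method on `Φ ∘ P` contracts the energy by the factor `1 - s`. -/
theorem nesterovEnergy_step {Φ : E → ℝ} {g : E → E} {s : ℝ}
    (hΦ : SmoothStrong (1 / L) (1 / μ) Φ g) (hP : IsPreconditioner ρ P) (hμ : 0 < μ) (hL : 0 < L)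
    (hs : 0 < s) (hs1 : s ≤ 1) (hsρ : s ^ 2 = ρ * μ / L) (u a b a' b' : E)
    (hb : b' = a - μ • g (P a))
    (ha : a' = (1 + (1 - s) / (1 + s)) • b' - ((1 - s) / (1 + s)) • b) :
    nesterovEnergy L ρ s P Φ u a' b' ≤ (1 - s) * nesterovEnergy L ρ s P Φ u a b := by
  set q := a - u with hq
  set p := a + s⁻¹ • (a - b) - u with hp
  set c := g (P a) with hc
  -- the third point averages `p` and `q` and makes a long gradient step
  have hw : a' + s⁻¹ • (a' - b') - u = (1 - s) • p + s • q - (μ / s) • c := by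
    rw [ha, hp, hq, hb]
    match_scalars <;> field_simp <;> ring
  -- descent of the gradient step
  have h1 : Φ (P b') ≤ Φ (P a) - μ / 2 * inner ℝ c (P c) := by
    have h := hΦ.upper (P a) (P b')
    have e : P b' - P a = -(μ • P c) := by rw [hb, map_sub, map_smul]; abel
    rw [e, inner_neg_right, inner_smul_right, norm_neg, norm_smul, mul_pow, Real.norm_eq_abs,
      sq_abs] at h
    have h' := hP.norm_sq_le c
    have e2 : 1 / μ / 2 * (μ ^ 2 * ‖P c‖ ^ 2) = μ / 2 * ‖P c‖ ^ 2 := by field_simp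
    rw [e2] at h
    nlinarith
  have h2 : Φ (P a) - inner ℝ c (P q) + ρ / (2 * L) * inner ℝ q (P q) ≤ Φ (P u) := by
    have h := hΦ.lower (P a) (P u)
    have e : P u - P a = -P q := by rw [hq, map_sub]; abel
    rw [e, inner_neg_right, norm_neg] at h
    have h' := hP.le_norm_sq q
    have e2 : ρ / (2 * L) * inner ℝ q (P q) = 1 / L / 2 * (ρ * inner ℝ q (P q)) := by ring
    have h3 : 1 / L / 2 * (ρ * inner ℝ q (P q)) ≤ 1 / L / 2 * ‖P q‖ ^ 2 := by gcongr
    linarith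
  have h3 : Φ (P a) - s * (inner ℝ c (P p) - inner ℝ c (P q)) ≤ Φ (P b) := by
    have h := hΦ.lower (P a) (P b)
    have e : b - a = -(s • (p - q)) := by
      rw [hp, hq]
      match_scalars <;> field_simp <;> ring
    rw [← map_sub, e, map_neg, inner_neg_right, map_smul, inner_smul_right, map_sub,
      inner_sub_right] at h
    have : 0 ≤ 1 / L / 2 * ‖-(s • (P p - P q))‖ ^ 2 := by positivity
    linarith
  -- convexity of the seminorm and expansion of the gradient step
  have h4 : inner ℝ ((1 - s) • p + s • q - (μ / s) • c) (P ((1 - s) • p + s • q - (μ / s) • c)) ≤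
      (1 - s) * inner ℝ p (P p) + s * inner ℝ q (P q)
      - 2 * (μ / s) * ((1 - s) * inner ℝ c (P p) + s * inner ℝ c (P q))
      + (μ / s) ^ 2 * inner ℝ c (P c) := by
    have h := hP.nonneg (p - q)
    have e1 : inner ℝ q (P p) = inner ℝ p (P q) := by rw [← hP.symm, real_inner_comm]
    have e2 : inner ℝ p (P c) = inner ℝ c (P p) := by rw [← hP.symm, real_inner_comm]
    have e3 : inner ℝ q (P c) = inner ℝ c (P q) := by rw [← hP.symm, real_inner_comm]
    simp only [map_sub, map_add, map_smul, inner_sub_left, inner_sub_right, inner_add_left,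
      inner_add_right, inner_smul_left, inner_smul_right, RCLike.conj_to_real, e1, e2, e3] at h ⊢
    nlinarith [mul_nonneg (mul_nonneg hs.le (sub_nonneg.2 hs1)) h]
  have e1 : ρ / (2 * L) * (2 * (μ / s)) = s := by
    have : ρ / (2 * L) * (2 * (μ / s)) = (ρ * μ / L) / s := by field_simp
    rw [this, ← hsρ]; field_simp
  -- the square of the gradient step cancels against the descent `h1`
  have e2 : ρ / (2 * L) * (μ / s) ^ 2 = μ / 2 := by
    have : ρ / (2 * L) * (μ / s) ^ 2 = (ρ * μ / L) / s ^ 2 * (μ / 2) := by field_simp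
    rw [this, ← hsρ]; field_simp
  have hρ : 0 ≤ ρ / (2 * L) := by
    have : ρ / (2 * L) = s ^ 2 / (2 * μ) := by rw [hsρ]; field_simp
    rw [this]; positivity
  have h5 := mul_le_mul_of_nonneg_left h4 hρ
  have h6 := mul_le_mul_of_nonneg_left h2 hs.le
  have h7 := mul_le_mul_of_nonneg_left h3 (sub_nonneg.2 hs1)
  have e3 : ρ / (2 * L) * ((1 - s) * inner ℝ p (P p) + s * inner ℝ q (P q)
      - 2 * (μ / s) * ((1 - s) * inner ℝ c (P p) + s * inner ℝ c (P q))
      + (μ / s) ^ 2 * inner ℝ c (P c)) =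
      ρ / (2 * L) * ((1 - s) * inner ℝ p (P p) + s * inner ℝ q (P q))
      - (ρ / (2 * L) * (2 * (μ / s))) * ((1 - s) * inner ℝ c (P p) + s * inner ℝ c (P q))
      + (ρ / (2 * L) * (μ / s) ^ 2) * inner ℝ c (P c) := by ring
  rw [e3, e1, e2] at h5
  unfold nesterovEnergy
  rw [hw]
  simp only [← hp]
  linarith

/-- The energy controls the distance of the extrapolated point from the solution. -/
theorem norm_sq_le_nesterovEnergy {Φ : E → ℝ} {g : E → E} {s : ℝ}
    (hΦ : SmoothStrong (1 / L) (1 / μ) Φ g) (hP : IsPreconditioner ρ P) (hL : 0 < L)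
    (hs : 0 < s) (hρ : 0 < ρ) (hρ1 : ρ ≤ 1) (u a b : E) (hu : P (g (P u)) = 0) :
    ‖P a - P u‖ ^ 2 ≤ 2 * L / ρ * nesterovEnergy L ρ s P Φ u a b := by
  set w := a + s⁻¹ • (a - b) with hw
  set A := Φ (P b) - Φ (P u) with hA
  set B := ρ / (2 * L) * inner ℝ (w - u) (P (w - u)) with hB
  have hV : nesterovEnergy L ρ s P Φ u a b = A + B := rfl
  have hA0 : 1 / L / 2 * ‖P (b - u)‖ ^ 2 ≤ A := by
    have h := hΦ.lower (P u) (P b)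
    rw [← map_sub, ← hP.symm, hu, inner_zero_left] at h
    linarith
  have hB0 : ρ / (2 * L) * ‖P (w - u)‖ ^ 2 ≤ B := by
    rw [hB]; gcongr; exact hP.norm_sq_le _
  -- `a` is a convex combination of `b` and `w`
  have e : P a - P u = (1 / (1 + s)) • P (b - u) + (s / (1 + s)) • P (w - u) := by
    rw [← map_sub, ← map_smul, ← map_smul, ← map_add, hw]
    congr 1
    match_scalars <;> field_simp <;> ring
  have h1 : ‖P a - P u‖ ^ 2 ≤
      1 / (1 + s) * ‖P (b - u)‖ ^ 2 + s / (1 + s) * ‖P (w - u)‖ ^ 2 := by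
    have h2 : ‖P a - P u‖ ≤ 1 / (1 + s) * ‖P (b - u)‖ + s / (1 + s) * ‖P (w - u)‖ := by
      rw [e]
      refine (norm_add_le _ _).trans_eq ?_
      rw [norm_smul, norm_smul, Real.norm_of_nonneg (by positivity),
        Real.norm_of_nonneg (by positivity)]
    refine (pow_le_pow_left₀ (norm_nonneg _) h2 2).trans ?_
    have h3 : s / (1 + s) = 1 - 1 / (1 + s) := by field_simp; ring
    have h4 : 0 ≤ 1 / (1 + s) * (s / (1 + s)) * (‖P (b - u)‖ - ‖P (w - u)‖) ^ 2 := by positivity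
    rw [h3] at h4 ⊢
    nlinarith
  have h2 : ‖P (b - u)‖ ^ 2 ≤ 2 * L / ρ * A := by
    have : ‖P (b - u)‖ ^ 2 ≤ 2 * L * A := by
      calc ‖P (b - u)‖ ^ 2 = 2 * L * (1 / L / 2 * ‖P (b - u)‖ ^ 2) := by field_simp
        _ ≤ _ := by gcongr
    refine this.trans ?_
    have hA' : 0 ≤ A := le_trans (by positivity) hA0
    rw [div_mul_eq_mul_div, le_div_iff₀ hρ]
    exact mul_le_of_le_one_right (by positivity) hρ1
  have h3 : ‖P (w - u)‖ ^ 2 ≤ 2 * L / ρ * B := by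
    calc ‖P (w - u)‖ ^ 2 = 2 * L / ρ * (ρ / (2 * L) * ‖P (w - u)‖ ^ 2) := by field_simp
      _ ≤ _ := by gcongr
  have hA' : 0 ≤ 2 * L / ρ * A := (sq_nonneg _).trans h2
  have hB' : 0 ≤ 2 * L / ρ * B := (sq_nonneg _).trans h3
  rw [hV, mul_add]
  have h5 : 1 / (1 + s) ≤ 1 := by rw [div_le_one (by positivity)]; linarith
  have h6 : s / (1 + s) ≤ 1 := by rw [div_le_one (by positivity)]; linarith
  have h7 : 0 ≤ 1 / (1 + s) := by positivity
  have h8 : 0 ≤ s / (1 + s) := by positivity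
  calc _ ≤ _ := h1
    _ ≤ 1 / (1 + s) * (2 * L / ρ * A) + s / (1 + s) * (2 * L / ρ * B) := by gcongr
    _ ≤ 1 * (2 * L / ρ * A) + 1 * (2 * L / ρ * B) := by gcongr
    _ = _ := by ring

/-- The energy at the starting point `0`. -/
theorem nesterovEnergy_zero_le {Φ : E → ℝ} {g : E → E} {s : ℝ}
    (hΦ : SmoothStrong (1 / L) (1 / μ) Φ g) (hP : IsPreconditioner ρ P) (hL : 0 < L)
    (hμL : μ ≤ L) (hμ : 0 < μ) (u : E) (hu : P (g (P u)) = 0) :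
    nesterovEnergy L ρ s P Φ u 0 0 ≤ 1 / μ * ‖P u‖ ^ 2 := by
  have h1 := hΦ.upper (P u) 0
  rw [zero_sub, inner_neg_right, ← hP.symm, hu, inner_zero_left, norm_neg] at h1
  have h2 := hP.le_norm_sq u
  have h3 : ρ / (2 * L) * inner ℝ u (P u) ≤ 1 / μ / 2 * ‖P u‖ ^ 2 := by
    calc ρ / (2 * L) * inner ℝ u (P u) = 1 / L / 2 * (ρ * inner ℝ u (P u)) := by ring
      _ ≤ 1 / L / 2 * ‖P u‖ ^ 2 := by gcongr
      _ ≤ _ := by gcongr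
  simp only [nesterovEnergy, map_zero, sub_zero, smul_zero, add_zero, zero_sub, map_neg,
    inner_neg_neg]
  linarith

end Abstract

/-! ### The primal method -/

section Abstract

variable {E : Type*} [NormedAddCommGroup E] [InnerProductSpace ℝ E]
  {ρ μ L : ℝ} {P : E →ₗ[ℝ] E}

/-- The quadratic form `⟪u, P u⟫ - ‖P u‖² / (1 + η μ)` that measures the dual error `P u` in the
primal-dual method; `c` stands for `(1 + η μ)⁻¹`. -/
def dualForm (c : ℝ) (P : E →ₗ[ℝ] E) (u : E) : ℝ := inner ℝ u (P u) - c * ‖P u‖ ^ 2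

theorem IsPreconditioner.dualForm_nonneg (hP : IsPreconditioner ρ P) {c : ℝ} (hc : c ≤ 1) (u : E) :
    0 ≤ dualForm c P u := by
  have := hP.norm_sq_le u
  have h2 : c * ‖P u‖ ^ 2 ≤ 1 * ‖P u‖ ^ 2 := by gcongr
  unfold dualForm; linarith

/-- The exact energy balance of one primal-dual step, in terms of the primal error `x`, the primal
displacement `e`, the dual error `P u`, the dual displacement `P v` and the gradient error `d`. -/
theorem primalDual_energy (hP : IsPreconditioner ρ P) {η c : ℝ} (x e d u v : E)
    (he : e = -(η • (d + μ • x + P u))) (hx : P x = η • (P v - c • P (P v))) :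
    (1 + 2 * η * μ) * ‖x‖ ^ 2 + η ^ 2 * dualForm c P u + η ^ 2 * dualForm c P v =
      ‖x - e‖ ^ 2 + η ^ 2 * dualForm c P (u - v) - ‖e‖ ^ 2 - 2 * η * inner ℝ d x := by
  have h1 : inner ℝ x e = -(η * (inner ℝ d x + μ * ‖x‖ ^ 2 +
      η * (inner ℝ u (P v) - c * inner ℝ (P u) (P v)))) := by
    have h2 : inner ℝ (P u) x = η * (inner ℝ u (P v) - c * inner ℝ (P u) (P v)) := by
      rw [hP.symm, hx, inner_smul_right, inner_sub_right, inner_smul_right, ← hP.symm u (P v)]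
    rw [real_inner_comm, he, inner_neg_left, inner_smul_left, RCLike.conj_to_real, inner_add_left,
      inner_add_left, inner_smul_left, RCLike.conj_to_real, real_inner_self_eq_norm_sq, h2]
  have h3 : inner ℝ v (P u) = inner ℝ u (P v) := by rw [← hP.symm, real_inner_comm]
  rw [norm_sub_sq_real, h1]
  unfold dualForm
  rw [map_sub, norm_sub_sq_real (P u), inner_sub_left, inner_sub_right, inner_sub_right, h3]
  ring

/-- The accelerated primal part: the term `⟪d, x⁺ - z⟫`, where `d` is the gradient error at the
extrapolated point `g`, pays for the change of the Bregman divergence. -/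
theorem accelerated_bregman {H : E → ℝ} {h : E → E} (hH : SmoothStrong 0 L H h) (hL : 0 < L)
    {τ : ℝ} (hτ : 0 < τ) (hτ1 : τ ≤ 1) (x x' f f' g z : E)
    (hg : g = τ • x + (1 - τ) • f) (hf : f' = g + (2 * τ / (2 - τ)) • (x' - x)) :
    (2 - τ) / (2 * τ) * bregman H h f' z + 1 / (2 * L) * ‖h g - h z‖ ^ 2 ≤
      (1 - τ) / τ * bregman H h f z + inner ℝ (h g - h z) (x' - z)
        + τ * L / (2 - τ) * ‖x' - x‖ ^ 2 := by
  have hτ2 : 0 < 2 - τ := by linarith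
  have h1 : 1 / (2 * L) * ‖h g - h z‖ ^ 2 ≤ bregman H h z g := by
    have := hH.norm_grad_sub_sq_le le_rfl hL z g
    rw [norm_sub_rev] at this
    rw [one_div_mul_eq_div, div_le_iff₀ (by positivity)]
    linarith
  have h2 : 0 ≤ bregman H h f g := by simpa using hH.lower_bregman f g
  have h3 := hH.bregman_upper f' g
  have h4 : 0 ≤ bregman H h g z := by simpa using hH.lower_bregman g z
  have e1 : f' - g = (2 * τ / (2 - τ)) • (x' - x) := by rw [hf]; abel
  have e2 : x' - z = ((2 - τ) / (2 * τ)) • (f' - g) + ((1 - τ) / τ) • (g - f) + (g - z) := by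
    rw [e1, hg]
    match_scalars <;> field_simp <;> ring
  rw [e1, norm_smul, mul_pow, Real.norm_eq_abs, sq_abs] at h3
  -- three-point identities
  have t1 : bregman H h f' z - bregman H h g z = bregman H h f' g +
      inner ℝ (h g - h z) (f' - g) := by
    simp only [bregman, inner_sub_left, inner_sub_right]; ring
  have t2 : bregman H h f z - bregman H h g z = bregman H h f g -
      inner ℝ (h g - h z) (g - f) := by
    simp only [bregman, inner_sub_left, inner_sub_right]; ring
  have t3 : inner ℝ (h g - h z) (g - z) = bregman H h g z + bregman H h z g := by
    simp only [bregman, inner_sub_left, inner_sub_right]; ring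
  have e3 : inner ℝ (h g - h z) (x' - z) = (2 - τ) / (2 * τ) * inner ℝ (h g - h z) (f' - g)
      + (1 - τ) / τ * inner ℝ (h g - h z) (g - f) + inner ℝ (h g - h z) (g - z) := by
    rw [e2, inner_add_right, inner_add_right, inner_smul_right, inner_smul_right]
  have k1 : 0 < (2 - τ) / (2 * τ) := by positivity
  have k2 : 0 ≤ (1 - τ) / τ := div_nonneg (by linarith) hτ.le
  have k3 : (2 - τ) / (2 * τ) = 1 / 2 + (1 - τ) / τ := by field_simp; ring
  have m1 := mul_le_mul_of_nonneg_left h3 k1.le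
  have m2 := mul_nonneg k2 h2
  have m3 : (2 - τ) / (2 * τ) * (L / 2 * ((2 * τ / (2 - τ)) ^ 2 * ‖x' - x‖ ^ 2)) =
      τ * L / (2 - τ) * ‖x' - x‖ ^ 2 := by
    field_simp
  rw [m3] at m1
  have i1 : inner ℝ (h g - h z) (f' - g) =
    bregman H h f' z - bregman H h g z - bregman H h f' g := by linarith
  have i2 : inner ℝ (h g - h z) (g - f) =
    bregman H h g z - bregman H h f z + bregman H h f g := by linarith
  rw [e3, i1, i2, t3]
  have k4 : (2 - τ) / (2 * τ) * bregman H h g z =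
    1 / 2 * bregman H h g z + (1 - τ) / τ * bregman H h g z := by rw [k3]; ring
  nlinarith

/-- The Lyapunov function of the primal method at the primal points `x`, `f` and the dual error
`P u`. -/
noncomputable def opapcEnergy (ρ μ τ η : ℝ) (P : E →ₗ[ℝ] E) (H : E → ℝ) (h : E → E)
    (z x f u : E) : ℝ :=
  (1 + η * μ) * ‖x - z‖ ^ 2 + (1 + τ * ρ / 6) * (η ^ 2 * dualForm (1 + η * μ)⁻¹ P u)
    + η * (2 - τ) / τ * bregman H h f z

theorem add_add_sq_le (a b c : ℝ) : (a + b + c) ^ 2 ≤ 3 * (a ^ 2 + b ^ 2 + c ^ 2) := by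
  linarith [sq_nonneg (a - b), sq_nonneg (a - c), sq_nonneg (b - c)]

set_option maxHeartbeats 800000 in
/-- One step of the primal method contracts the energy by the factor `1 - r`. -/
theorem opapcEnergy_step {H : E → ℝ} {h : E → E} (hH : SmoothStrong 0 L H h)
    (hP : IsPreconditioner ρ P) (hL : 0 < L) (hμ : 0 < μ) (hρ : 0 ≤ ρ) {τ η r : ℝ}
    (hτ : 0 < τ) (hτ1 : τ ≤ 1) (hη : 4 * τ * L * η = 1) (hημ : η * μ ≤ 1 / 2)
    (hr1 : 1 ≤ (1 - r) * (1 + η * μ)) (hr2 : 1 ≤ (1 - r) * (1 + τ * ρ / 6))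
    (hr3 : r ≤ τ / 2) (z x f u x' f' g w y : E)
    (hz : P z = 0) (hy : h z + μ • z + y = 0)
    (hg : g = τ • x + (1 - τ) • f)
    (hw : w = (1 + η * μ)⁻¹ • (x - η • (h g + (y + P u))))
    (hx' : x' = (1 + η * μ)⁻¹ • (x - η • (h g + (y + P (u + η⁻¹ • w)))))
    (hf' : f' = g + (2 * τ / (2 - τ)) • (x' - x)) :
    opapcEnergy ρ μ τ η P H h z x' f' (u + η⁻¹ • w) ≤
      (1 - r) * opapcEnergy ρ μ τ η P H h z x f u := by
  have hη0 : 0 < η := by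
    have : 0 < 4 * τ * L * η := by rw [hη]; norm_num
    exact pos_of_mul_pos_right this (by positivity)
  have hμη : 0 < 1 + η * μ := by positivity
  set c := (1 + η * μ)⁻¹ with hc
  have hc1 : c ≤ 1 := inv_le_one_of_one_le₀ (by nlinarith)
  set u' := u + η⁻¹ • w with hu'
  set d := h g - h z with hd
  have hy' : y = -(h z + μ • z) := (neg_eq_of_add_eq_zero_right hy).symm
  have e1 : x' - x = -(η • (d + μ • (x' - z) + P u')) := by
    have e : (1 + η * μ) • x' = x - η • (h g + (y + P u')) := by
      rw [hx', smul_smul, mul_inv_cancel₀ hμη.ne', one_smul]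
    rw [hy'] at e
    have e' : x = (1 + η * μ) • x' + η • (h g + (-(h z + μ • z) + P u')) := by rw [e]; abel
    rw [show x' - x = x' - _ from congrArg (x' - ·) e', hd]
    module
  have e2 : P (x' - z) = η • (P (η⁻¹ • w) - c • P (P (η⁻¹ • w))) := by
    have e : x' = w - c • P w := by
      have e3 : P u' = P u + η⁻¹ • P w := by rw [hu', map_add, map_smul]
      have e4 : x - η • (h g + (y + P u')) = (x - η • (h g + (y + P u))) - P w := by
        rw [e3]
        match_scalars <;> field_simp
      rw [hx', e4, smul_sub, ← hw]
    rw [map_sub, hz, sub_zero, e, map_sub, map_smul, map_smul, map_smul]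
    match_scalars <;> field_simp
  have hen := primalDual_energy hP (x' - z) (x' - x) d u' (η⁻¹ • w) e1 e2
  have e5 : x' - z - (x' - x) = x - z := by abel
  have e6 : u' - η⁻¹ • w = u := by rw [hu']; abel
  rw [e5, e6] at hen
  have hbv := hP.dualForm_nonneg hc1 (η⁻¹ • w)
  have hbu := hP.dualForm_nonneg hc1 u
  have hbu' := hP.dualForm_nonneg hc1 u'
  have hacc := accelerated_bregman hH hL hτ hτ1 x x' f f' g z hg hf'
  have hDf : 0 ≤ bregman H h f z := by simpa using hH.lower_bregman f z
  -- the dual error is controlled by the displacement, the gradient error and the primal error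
  have hdual : η ^ 2 * ‖P u'‖ ^ 2 ≤
      3 * (‖x' - x‖ ^ 2 + η ^ 2 * ‖d‖ ^ 2 + (η * μ) ^ 2 * ‖x' - z‖ ^ 2) := by
    have e7 : η • P u' = -(x' - x) - η • d - (η * μ) • (x' - z) := by
      rw [e1]; module
    have h1 : ‖η • P u'‖ ≤ ‖x' - x‖ + η * ‖d‖ + η * μ * ‖x' - z‖ := by
      rw [e7]
      refine (norm_sub_le _ _).trans (add_le_add ((norm_sub_le _ _).trans ?_) ?_)
      · rw [norm_neg, norm_smul, Real.norm_of_nonneg hη0.le]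
      · rw [norm_smul, Real.norm_of_nonneg (by positivity)]
    rw [norm_smul, Real.norm_of_nonneg hη0.le] at h1
    have h2 := pow_le_pow_left₀ (by positivity) h1 2
    rw [← mul_pow, ← mul_pow, ← mul_pow]
    exact h2.trans (add_add_sq_le _ _ _)
  have hb : ρ * dualForm c P u' ≤ ‖P u'‖ ^ 2 := by
    have h1 := hP.le_norm_sq u'
    have h2 : dualForm c P u' ≤ inner ℝ u' (P u') := by
      have : 0 ≤ c * ‖P u'‖ ^ 2 := by positivity
      unfold dualForm; linarith
    exact (mul_le_mul_of_nonneg_left h2 hρ).trans h1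
  have hηL : η * L * τ = 1 / 4 := by linarith
  have hτ2 : 0 < 2 - τ := by linarith
  have s1 : η * (2 - τ) / τ = 2 * η * ((2 - τ) / (2 * τ)) := by field_simp
  have s2 : 2 * η * (τ * L / (2 - τ)) ≤ 1 / 2 := by
    have : 2 * η * (τ * L / (2 - τ)) = 2 * (η * L * τ) / (2 - τ) := by ring
    rw [this, hηL, div_le_iff₀ hτ2]; linarith
  have s3 : 2 * η * (1 / (2 * L)) = η / L := by field_simp
  have hacc' := mul_le_mul_of_nonneg_left hacc (by positivity : 0 ≤ 2 * η)
  have s4 := mul_le_mul_of_nonneg_right s2 (sq_nonneg ‖x' - x‖)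
  -- the energy balance with the divergence terms inserted
  have main : (1 + 2 * η * μ) * ‖x' - z‖ ^ 2 + η ^ 2 * dualForm c P u'
      + η * (2 - τ) / τ * bregman H h f' z + 1 / 2 * ‖x' - x‖ ^ 2 + η / L * ‖d‖ ^ 2 ≤
      ‖x - z‖ ^ 2 + η ^ 2 * dualForm c P u + 2 * η * ((1 - τ) / τ) * bregman H h f z := by
    have : 0 ≤ η ^ 2 * dualForm c P (η⁻¹ • w) := by positivity
    rw [s1, ← s3]
    linarith
  have q1 : τ / 6 * (η ^ 2 * ‖P u'‖ ^ 2) ≤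
      1 / 2 * ‖x' - x‖ ^ 2 + η / L * ‖d‖ ^ 2 + η * μ * ‖x' - z‖ ^ 2 := by
    have h1 := mul_le_mul_of_nonneg_left hdual (by positivity : 0 ≤ τ / 6)
    have h2 : τ / 2 * ‖x' - x‖ ^ 2 ≤ 1 / 2 * ‖x' - x‖ ^ 2 := by gcongr
    have h3 : τ / 2 * η ^ 2 * ‖d‖ ^ 2 ≤ η / L * ‖d‖ ^ 2 := by
      gcongr
      rw [le_div_iff₀ hL]
      have : τ / 2 * η ^ 2 * L = η * (η * L * τ) / 2 := by ring
      rw [this, hηL]; linarith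
    have h4 : τ / 2 * (η * μ) ^ 2 * ‖x' - z‖ ^ 2 ≤ η * μ * ‖x' - z‖ ^ 2 := by
      have h5 : 0 < η * μ := by positivity
      have h6 : τ / 2 * (η * μ) ≤ 1 := by
        calc τ / 2 * (η * μ) ≤ 1 / 2 * (1 / 2) := by gcongr
          _ ≤ 1 := by norm_num
      have h7 := mul_le_mul_of_nonneg_right h6 h5.le
      refine mul_le_mul_of_nonneg_right ?_ (sq_nonneg _)
      linarith
    linarith
  have q2 : τ * ρ / 6 * (η ^ 2 * dualForm c P u') ≤ τ / 6 * (η ^ 2 * ‖P u'‖ ^ 2) := by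
    have h1 := mul_le_mul_of_nonneg_left hb (by positivity : 0 ≤ τ / 6 * η ^ 2)
    linarith
  have q3 : 2 * η * ((1 - τ) / τ) ≤ (1 - r) * (η * (2 - τ) / τ) := by
    have : 2 * (1 - τ) ≤ (1 - r) * (2 - τ) := by nlinarith
    have h1 : 2 * η * ((1 - τ) / τ) = η / τ * (2 * (1 - τ)) := by field_simp
    have h2 : (1 - r) * (η * (2 - τ) / τ) = η / τ * ((1 - r) * (2 - τ)) := by field_simp
    rw [h1, h2]; gcongr
  have r1 := mul_le_mul_of_nonneg_right hr1 (sq_nonneg ‖x - z‖)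
  have r2 := mul_le_mul_of_nonneg_right hr2 (by positivity : 0 ≤ η ^ 2 * dualForm c P u)
  have r3 := mul_le_mul_of_nonneg_right q3 hDf
  unfold opapcEnergy
  rw [← hc]
  linarith

/-- The energy dominates the squared distance to the solution. -/
theorem norm_sq_le_opapcEnergy {H : E → ℝ} {h : E → E} (hH : SmoothStrong 0 L H h)
    (hP : IsPreconditioner ρ P) (hμ : 0 < μ) (hρ : 0 ≤ ρ) {τ η : ℝ} (hτ : 0 < τ) (hτ1 : τ ≤ 1)
    (hη : 0 < η) (z x f u : E) : ‖x - z‖ ^ 2 ≤ opapcEnergy ρ μ τ η P H h z x f u := by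
  have hc1 : (1 + η * μ)⁻¹ ≤ 1 := inv_le_one_of_one_le₀ (by nlinarith)
  have hb := hP.dualForm_nonneg hc1 u
  have hD : 0 ≤ bregman H h f z := by simpa using hH.lower_bregman f z
  have hτ2 : 0 < 2 - τ := by linarith
  have h1 : 0 ≤ η * (2 - τ) / τ * bregman H h f z := by positivity
  have h2 : 0 ≤ η * μ * ‖x - z‖ ^ 2 := by positivity
  have h3 : 0 ≤ (1 + τ * ρ / 6) * (η ^ 2 * dualForm (1 + η * μ)⁻¹ P u) := by positivity
  unfold opapcEnergy
  linarith

/-- The energy at the starting point. -/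
theorem opapcEnergy_init_le {H : E → ℝ} {h : E → E} (hH : SmoothStrong 0 L H h)
    (hP : IsPreconditioner ρ P) (hμ : 0 < μ) (hμL : μ ≤ L) (hρ : 1 / 4 ≤ ρ) (hρ1 : ρ ≤ 1)
    {τ η : ℝ} (hτ : 0 < τ) (hτ1 : τ ≤ 1) (hτL : μ ≤ 4 * τ ^ 2 * L) (hη : 4 * τ * L * η = 1)
    (hημ : η * μ ≤ 1 / 2) (z x u : E) :
    opapcEnergy ρ μ τ η P H h z x x u ≤ 3 * (L / μ * (‖x - z‖ ^ 2 + ‖P u‖ ^ 2 / μ ^ 2)) := by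
  have hL : 0 < L := by linarith
  have hκ1 : 1 ≤ L / μ := by rwa [one_le_div hμ]
  have hη0 : η = 1 / (4 * τ * L) := by field_simp; linarith
  have hη1 : 0 < η := by rw [hη0]; positivity
  have hcoef : 0 ≤ η * (2 - τ) / τ := by
    have : 0 < 2 - τ := by linarith
    positivity
  have hηL : η * (2 - τ) / τ * (L / 2) ≤ L / μ := by
    have h1 : η * (2 - τ) / τ * (L / 2) = (2 - τ) / (8 * τ ^ 2) := by
      rw [hη0]; field_simp; ring
    rw [h1, div_le_div_iff₀ (by positivity) hμ]
    have h2 : (2 - τ) * μ ≤ 2 * μ := by nlinarith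
    linarith
  have h1 := mul_le_mul_of_nonneg_left (hH.bregman_upper x z) hcoef
  rw [← mul_assoc] at h1
  have h1' := h1.trans (mul_le_mul_of_nonneg_right hηL (sq_nonneg _))
  have h2 : dualForm (1 + η * μ)⁻¹ P u ≤ 4 * ‖P u‖ ^ 2 := by
    have h3 := hP.le_norm_sq u
    have h4 := mul_le_mul_of_nonneg_right hρ (hP.nonneg u)
    have h5 : 0 ≤ (1 + η * μ)⁻¹ * ‖P u‖ ^ 2 := by positivity
    unfold dualForm
    linarith
  have h3 : (1 + τ * ρ / 6) * (η ^ 2 * dualForm (1 + η * μ)⁻¹ P u) ≤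
      2 * (‖P u‖ ^ 2 / μ ^ 2) := by
    have h4 : τ * ρ ≤ 1 := mul_le_one₀ hτ1 (by linarith) hρ1
    have h5 : η ^ 2 ≤ (1 / 4) / μ ^ 2 := by
      rw [le_div_iff₀ (by positivity), ← mul_pow]
      calc (η * μ) ^ 2 ≤ (1 / 2) ^ 2 := by gcongr
        _ = 1 / 4 := by norm_num
    have h6 : η ^ 2 * dualForm (1 + η * μ)⁻¹ P u ≤ (1 / 4) / μ ^ 2 * (4 * ‖P u‖ ^ 2) :=
      (mul_le_mul_of_nonneg_left h2 (sq_nonneg _)).trans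
        (mul_le_mul_of_nonneg_right h5 (by positivity))
    have h7 : (1 / 4) / μ ^ 2 * (4 * ‖P u‖ ^ 2) = ‖P u‖ ^ 2 / μ ^ 2 := by ring
    rw [h7] at h6
    have h8 : 0 ≤ τ * ρ := mul_nonneg hτ.le (by linarith)
    refine mul_le_mul (by linarith) h6 ?_ two_pos.le
    exact mul_nonneg (sq_nonneg _) (hP.dualForm_nonneg (inv_le_one_of_one_le₀ (by nlinarith)) u)
  have h6 : (1 + η * μ) * ‖x - z‖ ^ 2 ≤ 2 * ‖x - z‖ ^ 2 :=
    mul_le_mul_of_nonneg_right (by linarith) (sq_nonneg _)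
  have h7 : 0 ≤ (L / μ - 1) * ‖x - z‖ ^ 2 := mul_nonneg (by linarith) (sq_nonneg _)
  have h9 : 0 ≤ ‖P u‖ ^ 2 / μ ^ 2 := by positivity
  have h8 : 0 ≤ (L / μ - 1) * (‖P u‖ ^ 2 / μ ^ 2) := mul_nonneg (by linarith) h9
  unfold opapcEnergy
  linarith

end Abstract

/-! ### Accelerated gossip as a preconditioner -/

section Gossip

theorem chebyshev_eval_half_add_inv {q : ℝ} (hq : q ≠ 0) (n : ℕ) :
    (Polynomial.Chebyshev.T ℝ n).eval ((q + q⁻¹) / 2) = (q ^ n + (q ^ n)⁻¹) / 2 := by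
  induction n using Nat.twoStepInduction with
  | zero => simp
  | one => simp
  | more n h0 h1 =>
    push_cast at h0 h1 ⊢
    rw [Polynomial.Chebyshev.T_add_two]
    simp only [Polynomial.eval_sub, Polynomial.eval_mul, Polynomial.eval_ofNat, Polynomial.eval_X,
      h0, h1]
    field_simp
    ring

variable {ι : Type*} [Fintype ι] [DecidableEq ι] {M : Matrix ι ι ℝ}

/-- The operator `c₂ (I - c₃ M)`, which maps the positive part of the spectrum of `M` into
`[-1, 1]` and the eigenvalue `0` to `c₂ > 1`. -/
noncomputable def shiftedGossip (M : Matrix ι ι ℝ) : Module.End ℝ (EuclideanSpace ℝ ι) :=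
  c₂ M • (1 - c₃ M • M.toEuclideanLin)

/-- The state after `j` further steps consists of consecutive Chebyshev polynomials. -/
theorem gossipStep_iterate (M : Matrix ι ι ℝ) (x : EuclideanSpace ℝ ι) (j : ℕ) :
    (gossipStep M)^[j] (gossipInit M x) =
      { aPrev := (Polynomial.Chebyshev.T ℝ j).eval (c₂ M)
        a := (Polynomial.Chebyshev.T ℝ (j + 1 : ℕ)).eval (c₂ M)
        xPrev := Polynomial.aeval (shiftedGossip M) (Polynomial.Chebyshev.T ℝ j) x
        x := Polynomial.aeval (shiftedGossip M) (Polynomial.Chebyshev.T ℝ (j + 1 : ℕ)) x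
        rounds := j + 1 } := by
  induction j with
  | zero => simp [gossipInit, shiftedGossip]
  | succ j ih =>
    rw [Function.iterate_succ_apply', ih]
    have e : ((j + 1 + 1 : ℕ) : ℤ) = (j : ℤ) + 2 := by push_cast; ring
    simp only [gossipStep, GossipState.mk.injEq, true_and, and_true]
    rw [e, Polynomial.Chebyshev.T_add_two]
    constructor
    · simp
    · have h2 : (2 : Polynomial ℝ) = Polynomial.C 2 := rfl
      rw [h2, map_sub, map_mul, map_mul, Polynomial.aeval_X, Polynomial.aeval_C]
      push_cast
      simp only [LinearMap.sub_apply, Module.End.mul_apply, Module.algebraMap_end_apply,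
        shiftedGossip, LinearMap.smul_apply, Module.End.one_apply]
      module

theorem gossipRounds_eq (hK : 1 ≤ gossipLength M) (x : EuclideanSpace ℝ ι) :
    gossipRounds M x = gossipLength M := by
  rw [gossipRounds, gossipFinal, gossipStep_iterate]
  exact Nat.sub_add_cancel hK

/-- Accelerated gossip as a linear operator. -/
noncomputable def gossipOperator (M : Matrix ι ι ℝ) : Module.End ℝ (EuclideanSpace ℝ ι) :=
  1 - ((Polynomial.Chebyshev.T ℝ (gossipLength M)).eval (c₂ M))⁻¹ •
    Polynomial.aeval (shiftedGossip M) (Polynomial.Chebyshev.T ℝ (gossipLength M))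

theorem acceleratedGossip_eq (hK : 1 ≤ gossipLength M) (x : EuclideanSpace ℝ ι) :
    acceleratedGossip M x = gossipOperator M x := by
  rw [acceleratedGossip, gossipFinal, gossipStep_iterate, Nat.sub_add_cancel hK]
  simp [gossipOperator]

/-- The reduction factor `c₁ ^ K` of accelerated gossip. -/
noncomputable def gossipRate (M : Matrix ι ι ℝ) : ℝ := c₁ M ^ gossipLength M

/-- Accelerated gossip, scaled so that its largest eigenvalue is at most `1`. -/
noncomputable def gossipPrecond (M : Matrix ι ι ℝ) : EuclideanSpace ℝ ι →ₗ[ℝ] EuclideanSpace ℝ ι :=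
  ((1 + gossipRate M ^ 2) / (1 + gossipRate M) ^ 2) • gossipOperator M

/-- The square root of the smallest positive eigenvalue that `gossipPrecond` is guaranteed to
have. -/
noncomputable def gossipGap (M : Matrix ι ι ℝ) : ℝ := (1 - gossipRate M) / (1 + gossipRate M)

theorem one_lt_sqrtChi (hχ : 1 < condNumber M) : 1 < sqrtChi M := by
  rw [sqrtChi]; exact Real.lt_sqrt_of_sq_lt (by simpa using hχ)

theorem one_le_gossipLength (hχ : 1 < condNumber M) : 1 ≤ gossipLength M :=
  Nat.le_floor (by simpa using (one_lt_sqrtChi hχ).le)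

theorem gossipRate_pos (hχ : 1 < condNumber M) : 0 < gossipRate M := by
  have := one_lt_sqrtChi hχ
  exact pow_pos (div_pos (by linarith) (by linarith)) _

/-- `⌊√χ⌋` rounds reduce the error by an absolute constant factor, by Bernoulli's inequality. -/
theorem gossipRate_le (hχ : 1 < condNumber M) : gossipRate M ≤ 1 / 3 := by
  have hs := one_lt_sqrtChi hχ
  have hK : sqrtChi M - 1 < gossipLength M := by
    rw [gossipLength]
    linarith [Nat.lt_floor_add_one (sqrtChi M)]
  have h1 : (c₁ M)⁻¹ = 1 + 2 / (sqrtChi M - 1) := by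
    rw [c₁]
    have : sqrtChi M - 1 ≠ 0 := by linarith
    field_simp
    ring
  have h0 : 0 < 2 / (sqrtChi M - 1) := div_pos two_pos (by linarith)
  have h2 := one_add_mul_le_pow (a := 2 / (sqrtChi M - 1)) (by linarith) (gossipLength M)
  have h3 : 2 ≤ (gossipLength M : ℝ) * (2 / (sqrtChi M - 1)) := by
    rw [← mul_div_assoc, le_div_iff₀ (by linarith)]
    linarith
  have h4 : 3 ≤ (gossipRate M)⁻¹ := by
    rw [gossipRate, ← inv_pow, h1]
    linarith
  have h5 := gossipRate_pos hχ
  rw [le_inv_comm₀ (by norm_num) h5] at h4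
  simpa using h4

theorem half_le_gossipGap (hχ : 1 < condNumber M) : 1 / 2 ≤ gossipGap M := by
  have h1 := gossipRate_pos hχ
  have h2 := gossipRate_le hχ
  rw [gossipGap, le_div_iff₀ (by linarith)]
  linarith

theorem gossipGap_lt_one (hχ : 1 < condNumber M) : gossipGap M < 1 := by
  have h1 := gossipRate_pos hχ
  rw [gossipGap, div_lt_one (by linarith)]
  linarith

theorem c₂_eq (hχ : 1 < condNumber M) : c₂ M = (c₁ M + (c₁ M)⁻¹) / 2 := by
  have hs := one_lt_sqrtChi hχ
  have h1 : condNumber M = sqrtChi M ^ 2 := (Real.sq_sqrt (by linarith)).symm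
  have h2 : sqrtChi M - 1 ≠ 0 := by linarith
  have h3 : sqrtChi M + 1 ≠ 0 := by linarith
  have h4 : sqrtChi M ^ 2 - 1 ≠ 0 := by nlinarith
  rw [c₂, c₁, h1]
  field_simp
  ring

/-- The normalization of the Chebyshev polynomial; its inverse is the error factor
`2 q / (1 + q ^ 2)` for `q = gossipRate M`. -/
theorem chebyshev_eval_c₂ (hχ : 1 < condNumber M) :
    (Polynomial.Chebyshev.T ℝ (gossipLength M)).eval (c₂ M) =
      (gossipRate M + (gossipRate M)⁻¹) / 2 := by
  have hs := one_lt_sqrtChi hχ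
  have hc : 0 < c₁ M := div_pos (by linarith) (by linarith)
  rw [c₂_eq hχ, chebyshev_eval_half_add_inv hc.ne', gossipRate]

/-- The eigenvalue of `gossipPrecond` that belongs to the eigenvalue `t` of the communication
matrix. -/
noncomputable def gossipEigenvalue (M : Matrix ι ι ℝ) (t : ℝ) : ℝ :=
  (1 + gossipRate M ^ 2) / (1 + gossipRate M) ^ 2 *
    (1 - ((Polynomial.Chebyshev.T ℝ (gossipLength M)).eval (c₂ M))⁻¹ *
      (Polynomial.Chebyshev.T ℝ (gossipLength M)).eval (c₂ M * (1 - c₃ M * t)))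

theorem gossipPrecond_apply_of_eigen {t : ℝ} {v : EuclideanSpace ℝ ι}
    (hv : M.toEuclideanLin v = t • v) : gossipPrecond M v = gossipEigenvalue M t • v := by
  rcases eq_or_ne v 0 with rfl | h0
  · simp
  have h1 : Module.End.HasEigenvector (shiftedGossip M) (c₂ M * (1 - c₃ M * t)) v := by
    rw [Module.End.hasEigenvector_iff, Module.End.mem_eigenspace_iff]
    refine ⟨?_, h0⟩
    simp only [shiftedGossip, LinearMap.smul_apply, LinearMap.sub_apply, Module.End.one_apply, hv]
    module
  simp only [gossipPrecond, gossipOperator, LinearMap.smul_apply, LinearMap.sub_apply,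
    Module.End.one_apply, Module.End.aeval_apply_of_hasEigenvector h1, gossipEigenvalue]
  module

theorem gossipEigenvalue_zero (hχ : 1 < condNumber M) : gossipEigenvalue M 0 = 0 := by
  have h1 := gossipRate_pos hχ
  have h2 : (gossipRate M + (gossipRate M)⁻¹) / 2 ≠ 0 := by positivity
  rw [gossipEigenvalue, mul_zero, sub_zero, mul_one, chebyshev_eval_c₂ hχ, inv_mul_cancel₀ h2,
    sub_self, mul_zero]

theorem lambdaMinPos_pos (hχ : 1 < condNumber M) : 0 < lambdaMinPos M := by
  have h1 : 0 ≤ lambdaMinPos M := Real.sInf_nonneg fun t ht => ht.2.le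
  refine h1.lt_of_ne fun h => ?_
  rw [condNumber, ← h, div_zero] at hχ
  linarith

/-- `shiftedGossip` maps the positive spectrum into `[-1, 1]`, where the Chebyshev polynomial is
bounded by `1`. -/
theorem gossipEigenvalue_mem (hχ : 1 < condNumber M) {t : ℝ} (h1 : lambdaMinPos M ≤ t)
    (h2 : t ≤ lambdaMax M) :
    gossipGap M ^ 2 ≤ gossipEigenvalue M t ∧ gossipEigenvalue M t ≤ 1 := by
  have hq := gossipRate_pos hχ
  have hm := lambdaMinPos_pos hχ
  have hM : lambdaMax M = condNumber M * lambdaMinPos M := by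
    rw [condNumber, div_mul_cancel₀ _ hm.ne']
  set χ := condNumber M with hχdef
  have h3 : c₂ M * (1 - c₃ M * t) = (χ + 1 - 2 * (t / lambdaMinPos M)) / (χ - 1) := by
    have : χ - 1 ≠ 0 := by linarith
    have : χ + 1 ≠ 0 := by linarith
    have : χ ≠ 0 := by linarith
    rw [c₂, c₃, ← hχdef, hM]
    field_simp
  have h4 : 1 ≤ t / lambdaMinPos M := by rwa [one_le_div hm]
  have h5 : t / lambdaMinPos M ≤ χ := by rw [div_le_iff₀ hm, ← hM]; exact h2
  have h6 : |c₂ M * (1 - c₃ M * t)| ≤ 1 := by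
    rw [h3, abs_le]
    constructor
    · rw [le_div_iff₀ (by linarith)]; linarith
    · rw [div_le_one (by linarith)]; linarith
  have h7 := Polynomial.Chebyshev.abs_eval_T_real_le_one (gossipLength M) h6
  rw [abs_le] at h7
  have h8 : ((gossipRate M + (gossipRate M)⁻¹) / 2)⁻¹ =
      2 * gossipRate M / (1 + gossipRate M ^ 2) := by field_simp; ring
  rw [gossipEigenvalue, chebyshev_eval_c₂ hχ, h8, gossipGap]
  set e := (Polynomial.Chebyshev.T ℝ (gossipLength M)).eval (c₂ M * (1 - c₃ M * t))
  have h9 : (1 + gossipRate M ^ 2) / (1 + gossipRate M) ^ 2 *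
      (1 - 2 * gossipRate M / (1 + gossipRate M ^ 2) * e) =
      (1 + gossipRate M ^ 2 - 2 * gossipRate M * e) / (1 + gossipRate M) ^ 2 := by field_simp
  rw [h9, div_pow]
  constructor
  · gcongr
    nlinarith
  · rw [div_le_one (by positivity)]
    nlinarith

theorem eigenvalues_eq_zero_or_mem (hM : M.PosSemidef) (i : ι) :
    hM.isHermitian.eigenvalues i = 0 ∨ (lambdaMinPos M ≤ hM.isHermitian.eigenvalues i ∧
      hM.isHermitian.eigenvalues i ≤ lambdaMax M) := by
  have hmem : hM.isHermitian.eigenvalues i ∈ spectrum ℝ M := by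
    rw [hM.isHermitian.spectrum_real_eq_range_eigenvalues]; exact ⟨i, rfl⟩
  rcases (hM.eigenvalues_nonneg i).eq_or_lt' with h | h
  · exact Or.inl h
  · refine Or.inr ⟨csInf_le ⟨0, fun t ht => ht.2.le⟩ ⟨hmem, h⟩, le_csSup ?_ hmem⟩
    rw [hM.isHermitian.spectrum_real_eq_range_eigenvalues]
    exact (Set.finite_range _).bddAbove

theorem toEuclideanLin_eigenvectorBasis (hM : M.IsHermitian) (i : ι) :
    M.toEuclideanLin (hM.eigenvectorBasis i) = hM.eigenvalues i • hM.eigenvectorBasis i := by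
  ext j
  exact congrFun (hM.mulVec_eigenvectorBasis i) j

theorem gossipPrecond_eigenvectorBasis (hM : M.IsHermitian) (i : ι) :
    gossipPrecond M (hM.eigenvectorBasis i) =
      gossipEigenvalue M (hM.eigenvalues i) • hM.eigenvectorBasis i :=
  gossipPrecond_apply_of_eigen (toEuclideanLin_eigenvectorBasis hM i)

/-- An operator that is diagonal in an orthonormal basis, with all nonzero eigenvalues in
`[ρ, 1]`, is a preconditioner. -/
theorem isPreconditioner_of_eigenbasis {E : Type*} [NormedAddCommGroup E] [InnerProductSpace ℝ E]
    (b : OrthonormalBasis ι ℝ E) {P : E →ₗ[ℝ] E} {a : ι → ℝ} {ρ : ℝ} (hρ : 0 ≤ ρ)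
    (hP : ∀ i, P (b i) = a i • b i) (ha : ∀ i, a i = 0 ∨ (ρ ≤ a i ∧ a i ≤ 1)) :
    IsPreconditioner ρ P := by
  have hcoord : ∀ i u, inner ℝ (b i) (P u) = a i * inner ℝ (b i) u := by
    intro i u
    conv_lhs => rw [← b.sum_repr u]
    conv_rhs => rw [← b.sum_repr u]
    simp only [map_sum, map_smul, hP, inner_sum, inner_smul_right, b.inner_eq_ite]
    simp [mul_comm]
  have hform : ∀ u v, inner ℝ u (P v) = ∑ i, a i * (inner ℝ (b i) u * inner ℝ (b i) v) := by
    intro u v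
    rw [← b.sum_inner_mul_inner]
    refine Finset.sum_congr rfl fun i _ => ?_
    rw [hcoord, real_inner_comm]; ring
  have hnorm : ∀ u, ‖P u‖ ^ 2 = ∑ i, a i * (a i * inner ℝ (b i) u ^ 2) := by
    intro u
    rw [← real_inner_self_eq_norm_sq, hform]
    refine Finset.sum_congr rfl fun i _ => ?_
    rw [hcoord]; ring
  refine ⟨fun u v => ?_, fun u => ?_, fun u => ?_⟩
  · rw [real_inner_comm, hform, hform]
    exact Finset.sum_congr rfl fun i _ => by ring
  · rw [hnorm, hform]
    refine Finset.sum_le_sum fun i _ => ?_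
    rw [← sq]
    rcases ha i with h | ⟨h, h'⟩
    · simp [h]
    · have := hρ.trans h
      gcongr
      exact mul_le_of_le_one_left (sq_nonneg _) h'
  · rw [hnorm, hform, Finset.mul_sum]
    refine Finset.sum_le_sum fun i _ => ?_
    rw [← sq]
    rcases ha i with h | ⟨h, h'⟩
    · simp [h]
    · have := hρ.trans h
      have h3 : 0 ≤ a i * inner ℝ (b i) u ^ 2 := by positivity
      nlinarith

theorem isPreconditioner_gossipPrecond (hM : M.PosSemidef) (hχ : 1 < condNumber M) :
    IsPreconditioner (gossipGap M ^ 2) (gossipPrecond M) := by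
  refine isPreconditioner_of_eigenbasis hM.isHermitian.eigenvectorBasis (sq_nonneg _)
    (gossipPrecond_eigenvectorBasis hM.isHermitian) fun i => ?_
  rcases eigenvalues_eq_zero_or_mem hM i with h | h
  · exact Or.inl (by rw [h, gossipEigenvalue_zero hχ])
  · exact Or.inr (gossipEigenvalue_mem hχ h.1 h.2)

theorem gossipPrecond_apply_of_ker (hχ : 1 < condNumber M) {z : EuclideanSpace ℝ ι}
    (hz : M.toEuclideanLin z = 0) : gossipPrecond M z = 0 := by
  rw [gossipPrecond_apply_of_eigen (t := 0) (by rw [hz, zero_smul]), gossipEigenvalue_zero hχ,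
    zero_smul]

/-- The range of `gossipPrecond` contains the orthogonal complement of the kernel of `M`. -/
theorem exists_gossipPrecond_eq (hM : M.PosSemidef) (hχ : 1 < condNumber M)
    {y : EuclideanSpace ℝ ι} (hy : ∀ z, M.toEuclideanLin z = 0 → inner ℝ z y = 0) :
    ∃ u, gossipPrecond M u = y := by
  set b := hM.isHermitian.eigenvectorBasis with hb
  refine ⟨∑ i, (inner ℝ (b i) y / gossipEigenvalue M (hM.isHermitian.eigenvalues i)) • b i, ?_⟩
  conv_rhs => rw [← b.sum_repr' y]
  rw [map_sum]
  refine Finset.sum_congr rfl fun i _ => ?_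
  rw [map_smul, hb, gossipPrecond_eigenvectorBasis, ← hb, smul_smul]
  congr 1
  rcases eigenvalues_eq_zero_or_mem hM i with h | h
  · rw [hy (b i) (by rw [hb, toEuclideanLin_eigenvectorBasis, h, zero_smul])]
    simp
  · have h1 := (gossipEigenvalue_mem hχ h.1 h.2).1
    have h2 := half_le_gossipGap hχ
    exact div_mul_cancel₀ _ (by nlinarith)

theorem inner_toEuclideanLin (hM : M.IsHermitian) (u v : EuclideanSpace ℝ ι) :
    inner ℝ (M.toEuclideanLin u) v = inner ℝ u (M.toEuclideanLin v) :=
  Matrix.isSymmetric_toEuclideanLin_iff.2 hM u v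

end Gossip

/-! ### Communication complexity of the two methods -/

/-- Linear convergence at rate `1 - 1 / (50 √κ)`, with `K ≤ D` rounds per iteration, yields the
complexity `O(√κ D ln (R / ε))`. -/
theorem reachesWithin_of_linear {err : ℕ → ℝ} {rounds : ℕ → ℕ} {s D R ε : ℝ} {K : ℕ}
    (hs : 1 ≤ s) (hK : (K : ℝ) ≤ D) (hε : 0 < ε) (hεR : ε ≤ R / 2)
    (hrounds : ∀ t, rounds t = t * K)
    (herr : ∀ t, err t ≤ 8 * (1 - 1 / (50 * s)) ^ t * R) :
    ReachesWithin err rounds ε (202 * s * D * Real.log (R / ε)) := by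
  have hR : 0 < R := by linarith
  have h2 : 2 ≤ R / ε := by rw [le_div_iff₀ hε]; linarith
  set l := Real.log (R / ε) with hl
  have hl2 : 1 / 2 ≤ l := by
    have h1 := Real.log_le_log two_pos h2
    have h3 := Real.log_two_gt_d9
    linarith
  -- since `R / ε ≥ 2`, the factor `8` costs at most `3 ln (R / ε)` and rounding up at most `2 s l`
  refine ⟨⌈200 * s * l⌉₊, ?_, fun t ht => ?_⟩
  · have h3 : (⌈200 * s * l⌉₊ : ℝ) ≤ 200 * s * l + 1 := (Nat.ceil_lt_add_one (by positivity)).le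
    have h4 : (⌈200 * s * l⌉₊ : ℝ) ≤ 202 * s * l := by nlinarith
    rw [hrounds]
    push_cast
    calc (⌈200 * s * l⌉₊ : ℝ) * K ≤ 202 * s * l * D := by gcongr
      _ = _ := by ring
  · have h3 : 200 * s * l ≤ t := (Nat.le_ceil _).trans (by exact_mod_cast ht)
    have h4 : (1 - 1 / (50 * s)) ^ t ≤ Real.exp (-(4 * l)) := by
      have h5 : 1 - 1 / (50 * s) ≤ Real.exp (-(1 / (50 * s))) := Real.one_sub_le_exp_neg _
      have h6 : 0 ≤ 1 - 1 / (50 * s) := by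
        rw [sub_nonneg, div_le_one (by positivity)]; linarith
      refine (pow_le_pow_left₀ h6 h5 t).trans ?_
      rw [← Real.exp_nat_mul, Real.exp_le_exp]
      have : 4 * l ≤ t * (1 / (50 * s)) := by
        rw [mul_one_div, le_div_iff₀ (by positivity)]; linarith
      linarith
    have h7 : Real.exp (-(4 * l)) = (ε / R) ^ 4 := by
      have : -(4 * l) = ((4 : ℕ) : ℝ) * Real.log (ε / R) := by
        rw [hl, ← inv_div ε R, Real.log_inv]; push_cast; ring
      rw [this, Real.exp_nat_mul, Real.exp_log (by positivity)]
    have h8 : ε / R ≤ 1 / 2 := by rw [div_le_iff₀ hR]; linarith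
    calc err t ≤ 8 * (1 - 1 / (50 * s)) ^ t * R := herr t
      _ ≤ 8 * (ε / R) ^ 4 * R := by rw [← h7]; gcongr
      _ = 8 * (ε / R) ^ 3 * ε := by field_simp
      _ ≤ 8 * (1 / 2) ^ 3 * ε := by gcongr
      _ = ε := by ring

section Methods

variable {V : Type*} [Fintype V] [DecidableEq V]
  {S : V → Type*} [∀ i, Fintype (S i)] [∀ i, DecidableEq (S i)]
  {L μ : ℝ} {M : Matrix (Σ i, S i) (Σ i, S i) ℝ} {f : ∀ i, EuclideanSpace ℝ (S i) → ℝ}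
  {z : EuclideanSpace ℝ (Σ i, S i)}

theorem msdaStepSize_smul (hχ : 1 < condNumber M) (x : EuclideanSpace ℝ (Σ i, S i)) :
    msdaStepSize μ M • acceleratedGossip M x = μ • gossipPrecond M x := by
  rw [acceleratedGossip_eq (one_le_gossipLength hχ), gossipPrecond, LinearMap.smul_apply, smul_smul,
    msdaStepSize, pow_mul', gossipRate, mul_div_assoc]

theorem msdaMomentum_eq (hμ : 0 < μ) (hμL : μ ≤ L) (hχ : 1 < condNumber M) :
    msdaMomentum L μ M =
      (1 - gossipGap M / √(L / μ)) / (1 + gossipGap M / √(L / μ)) := by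
  have h1 := gossipRate_pos hχ
  have h2 := gossipRate_le hχ
  have h3 : 0 < √(L / μ) := Real.sqrt_pos.2 (div_pos (by linarith) hμ)
  rw [msdaMomentum, gossipGap, ← gossipRate]
  have h4 : (1 + gossipRate M) * √(L / μ) + 1 - gossipRate M ≠ 0 := by
    have : 0 < (1 + gossipRate M) * √(L / μ) := by positivity
    linarith
  have h5 : (1 + gossipRate M) * √(L / μ) + (1 - gossipRate M) ≠ 0 := by rwa [← add_sub_assoc]
  field_simp
  ring

/-- MSDA is Nesterov's method on the conjugate, preconditioned by accelerated gossip. -/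
theorem msda_invariant (hμ : 0 < μ) (hμL : μ ≤ L) (hM : M.PosSemidef) (hχ : 1 < condNumber M)
    {Φ : EuclideanSpace ℝ (Σ i, S i) → ℝ}
    (hΦ : SmoothStrong (1 / L) (1 / μ) Φ (nodewise fun i => ∇ (conjugate (f i))))
    (u : EuclideanSpace ℝ (Σ i, S i)) (t : ℕ) :
    (msda L μ M f t).rounds = t * gossipLength M ∧
    ∃ a b, (msda L μ M f t).x = gossipPrecond M a ∧ (msda L μ M f t).y = gossipPrecond M b ∧
      nesterovEnergy L (gossipGap M ^ 2) (gossipGap M / √(L / μ)) (gossipPrecond M) Φ u a b ≤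
        (1 - gossipGap M / √(L / μ)) ^ t *
          nesterovEnergy L (gossipGap M ^ 2) (gossipGap M / √(L / μ)) (gossipPrecond M) Φ u 0 0 := by
  have hL : 0 < L := by linarith
  have hg := half_le_gossipGap hχ
  have hg1 := gossipGap_lt_one hχ
  have hκ : 1 ≤ √(L / μ) := by rwa [Real.one_le_sqrt, one_le_div hμ]
  have hs1 : gossipGap M / √(L / μ) ≤ 1 := by rw [div_le_one (by positivity)]; linarith
  induction t with
  | zero => exact ⟨by simp [msda], 0, 0, by simp [msda], by simp [msda], by simp⟩
  | succ t ih =>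
    obtain ⟨hr, a, b, ha, hb, hV⟩ := ih
    have hstep : msda L μ M f (t + 1) = msdaStep L μ M f (msda L μ M f t) := by
      rw [msda, Function.iterate_succ_apply']; rfl
    rw [hstep]
    refine ⟨?_, (1 + msdaMomentum L μ M) • (a - μ • msdaPrimal f (msda L μ M f t)) -
      msdaMomentum L μ M • b, a - μ • msdaPrimal f (msda L μ M f t), ?_, ?_, ?_⟩
    · simp only [msdaStep, hr, gossipRounds_eq (one_le_gossipLength hχ)]
      ring
    · simp only [msdaStep, msdaStepSize_smul hχ, map_sub, map_smul, ha, hb]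
    · simp only [msdaStep, msdaStepSize_smul hχ, map_sub, map_smul, ha]
    · have hstep := nesterovEnergy_step hΦ (isPreconditioner_gossipPrecond hM hχ) hμ hL
        (s := gossipGap M / √(L / μ)) (by positivity) hs1
        (by rw [div_pow, Real.sq_sqrt (by positivity)]; field_simp) u a b _
        (b' := a - μ • msdaPrimal f (msda L μ M f t)) (by rw [msdaPrimal, ha]) rfl
      rw [msdaMomentum_eq hμ hμL hχ, pow_succ' (1 - _) t, mul_assoc]
      exact hstep.trans (mul_le_mul_of_nonneg_left hV (by linarith))

/-- Complexity of MSDA for a general communication matrix: `z` is the stacked solution, which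
consists of its consensus `M z = 0` and of the optimality condition that `∇F(z)` is orthogonal to
the kernel of `M`. -/
theorem msdaComplexity_of_optimal (hμ : 0 < μ) (hμL : μ ≤ L) (hM : M.PosSemidef)
    (hχ : 1 < condNumber M) {D : ℝ} (hD : sqrtChi M ≤ D)
    (hf : ∀ i, LSmooth L (f i)) (hc : ∀ i, StrongConvexOn Set.univ μ (f i))
    (hz : M.toEuclideanLin z = 0)
    (hopt : ∀ w, M.toEuclideanLin w = 0 → inner ℝ w (nodewise (fun i => ∇ (f i)) z) = 0) :
    MSDAComplexity L μ M f z (202 * √(L / μ) * D) := by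
  intro R ε hR hε hεR
  have hL : 0 < L := by linarith
  have hκ : 1 ≤ √(L / μ) := by rwa [Real.one_le_sqrt, one_le_div hμ]
  have hg := half_le_gossipGap hχ
  have hg1 := gossipGap_lt_one hχ
  have hF := SmoothStrong.stackedSum fun i => (hf i).smoothStrong (hc i)
  obtain ⟨hinv, hinv'⟩ := nodewise_gradient_conjugate hμ hf hc
  have hΦ := hF.dual hμ hL hinv'
  have hP := isPreconditioner_gossipPrecond hM hχ
  obtain ⟨u, hu⟩ := exists_gossipPrecond_eq hM hχ hopt
  have hu' : gossipPrecond M (nodewise (fun i => ∇ (conjugate (f i))) (gossipPrecond M u)) = 0 := by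
    rw [hu, hinv]; exact gossipPrecond_apply_of_ker hχ hz
  set s := gossipGap M / √(L / μ) with hs
  have hs0 : 0 < s := by positivity
  have hs1 : s ≤ 1 := by rw [hs, div_le_one (by positivity)]; linarith
  have hs50 : 1 / (50 * √(L / μ)) ≤ s := by
    rw [hs, div_le_div_iff₀ (by positivity) (by positivity)]
    nlinarith
  have hgap : 1 / 4 ≤ gossipGap M ^ 2 := by nlinarith
  refine reachesWithin_of_linear (K := gossipLength M) hκ
    ((Nat.floor_le (Real.sqrt_nonneg _)).trans hD) hε hεR
    (fun t => (msda_invariant hμ hμL hM hχ hΦ u t).1) fun t => ?_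
  obtain ⟨-, a, b, ha, -, hV⟩ := msda_invariant hμ hμL hM hχ hΦ u t
  have h0 := nesterovEnergy_zero_le (s := s) hΦ hP hL hμL hμ u hu'
  have h1 := norm_sq_le_nesterovEnergy hΦ hP hL hs0 (by positivity)
    (by nlinarith) u a b hu'
  have h2 := hF.mul_norm_sub_le (msdaPrimal f (msda L μ M f t)) z
  have e : nodewise (fun i => ∇ (f i)) (msdaPrimal f (msda L μ M f t)) = gossipPrecond M a := by
    rw [msdaPrimal, hinv', ha]
  rw [e, ← hu] at h2
  have h3 := pow_le_pow_left₀ (by positivity) h2 2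
  rw [mul_pow] at h3
  rw [hu] at h0
  have h4 : 2 * L / gossipGap M ^ 2 ≤ 8 * L := by
    rw [div_le_iff₀ (by positivity)]; nlinarith
  set N := ‖nodewise (fun i => ∇ (f i)) z‖ ^ 2 with hN
  have h5 : μ ^ 2 * ‖msdaPrimal f (msda L μ M f t) - z‖ ^ 2 ≤
      8 * L * ((1 - s) ^ t * (1 / μ * N)) := by
    have h6 : 0 ≤ (1 - s) ^ t := pow_nonneg (by linarith) _
    calc _ ≤ _ := h3.trans h1
      _ ≤ 2 * L / gossipGap M ^ 2 * ((1 - s) ^ t * (1 / μ * N)) := by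
        refine mul_le_mul_of_nonneg_left (hV.trans ?_) (by positivity)
        exact mul_le_mul_of_nonneg_left h0 h6
      _ ≤ _ := by gcongr
  have h6 : (1 - s) ^ t ≤ (1 - 1 / (50 * √(L / μ))) ^ t :=
    pow_le_pow_left₀ (by linarith) (by linarith) t
  have h7 : 0 ≤ (1 - 1 / (50 * √(L / μ))) ^ t := pow_nonneg (by linarith) t
  calc ‖msdaPrimal f (msda L μ M f t) - z‖ ^ 2
      = (μ ^ 2 * ‖msdaPrimal f (msda L μ M f t) - z‖ ^ 2) / μ ^ 2 := by field_simp
    _ ≤ (8 * L * ((1 - s) ^ t * (1 / μ * N))) / μ ^ 2 := by gcongr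
    _ = 8 * (1 - s) ^ t * (L / μ * (N / μ ^ 2)) := by field_simp
    _ ≤ 8 * (1 - 1 / (50 * √(L / μ))) ^ t * R := by gcongr

/-- The step parameter `τ` has the order of `1 / √κ`. -/
theorem opapcTau_bounds (hμ : 0 < μ) (hμL : μ ≤ L) (hχ : 1 < condNumber M) :
    0 < opapcTau L μ M ∧ 1 ≤ 2 * √(L / μ) * opapcTau L μ M ∧ √(L / μ) * opapcTau L μ M ≤ 1 ∧
      opapcTau L μ M ≤ 1 := by
  have h1 := gossipRate_pos hχ
  have h2 := gossipRate_le hχ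
  have hκ : 1 ≤ √(L / μ) := by rwa [Real.one_le_sqrt, one_le_div hμ]
  rw [opapcTau, ← gossipRate]
  refine ⟨?_, ?_, ?_, min_le_left _ _⟩
  · refine lt_min one_pos (div_pos (by linarith) (mul_pos (by positivity) (by linarith)))
  · rw [mul_min_of_nonneg _ _ (by positivity), le_min_iff]
    refine ⟨by linarith, ?_⟩
    rw [← mul_div_assoc, mul_div_mul_left _ _ (by positivity), le_div_iff₀] <;> linarith
  · refine (mul_le_mul_of_nonneg_left (min_le_right _ _) (by positivity)).trans ?_
    rw [← mul_div_assoc, div_le_one] <;> nlinarith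

theorem opapcTheta_smul (hχ : 1 < condNumber M) (x : EuclideanSpace ℝ (Σ i, S i)) :
    opapcTheta L μ M • acceleratedGossip M x =
      gossipPrecond M ((opapcEta L μ M)⁻¹ • x) := by
  rw [acceleratedGossip_eq (one_le_gossipLength hχ), gossipPrecond, LinearMap.smul_apply, map_smul,
    smul_smul, opapcTheta, pow_mul', gossipRate, mul_comm (opapcEta L μ M), div_mul_eq_div_div,
    div_eq_mul_inv _ (opapcEta L μ M)]

/-- A growth by `k / 48` compensates a contraction by `k / 50`; this is the weakest of the three
rates in the energy of OPAPC. -/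
theorem one_le_one_sub_mul {k x : ℝ} (hk : 0 ≤ k) (hk1 : k ≤ 1) (hx : k / 48 ≤ x) :
    1 ≤ (1 - k / 50) * (1 + x) := by
  have h1 : (1 - k / 50) * (1 + k / 48) ≤ (1 - k / 50) * (1 + x) := by
    apply mul_le_mul_of_nonneg_left <;> linarith
  nlinarith

/-- Every iteration of OPAPC contracts its energy. The dual solution is `-∇F(z)`, and the dual error
remains in the range of the preconditioner. -/
theorem opapc_invariant (hμ : 0 < μ) (hμL : μ ≤ L) (hM : M.PosSemidef) (hχ : 1 < condNumber M)
    {F : EuclideanSpace ℝ (Σ i, S i) → ℝ}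
    (hF : SmoothStrong μ L F (nodewise fun i => ∇ (f i)))
    (hz : M.toEuclideanLin z = 0) (x₀ y₀ u₀ : EuclideanSpace ℝ (Σ i, S i))
    (hu : gossipPrecond M u₀ = y₀ + nodewise (fun i => ∇ (f i)) z) (t : ℕ) :
    (opapc L μ M f x₀ y₀ t).rounds = t * gossipLength M ∧
    ∃ u, (opapc L μ M f x₀ y₀ t).y = -nodewise (fun i => ∇ (f i)) z + gossipPrecond M u ∧
      opapcEnergy (gossipGap M ^ 2) μ (opapcTau L μ M) (opapcEta L μ M) (gossipPrecond M)
        (fun x => F x - μ / 2 * ‖x‖ ^ 2) (fun x => nodewise (fun i => ∇ (f i)) x - μ • x) z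
        (opapc L μ M f x₀ y₀ t).x (opapc L μ M f x₀ y₀ t).xf u ≤
      (1 - 1 / (50 * √(L / μ))) ^ t *
        opapcEnergy (gossipGap M ^ 2) μ (opapcTau L μ M) (opapcEta L μ M) (gossipPrecond M)
          (fun x => F x - μ / 2 * ‖x‖ ^ 2) (fun x => nodewise (fun i => ∇ (f i)) x - μ • x) z
          x₀ x₀ u₀ := by
  have hL : 0 < L := by linarith
  have hκ : 1 ≤ √(L / μ) := by rwa [Real.one_le_sqrt, one_le_div hμ]
  have hκ2 : √(L / μ) ^ 2 = L / μ := Real.sq_sqrt (by positivity)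
  have hg := half_le_gossipGap hχ
  have hgap : 1 / 4 ≤ gossipGap M ^ 2 := by nlinarith
  obtain ⟨hτ, hτ2, hτ3, hτ1⟩ := opapcTau_bounds hμ hμL hχ
  set τ := opapcTau L μ M with hτdef
  have hηdef : opapcEta L μ M = 1 / (4 * τ * L) := rfl
  set η := opapcEta L μ M
  have hη : 4 * τ * L * η = 1 := by rw [hηdef]; field_simp
  have hkdef : 1 / (50 * √(L / μ)) = (√(L / μ))⁻¹ / 50 := by field_simp
  set k := (√(L / μ))⁻¹ with hk
  have hk0 : 0 < k := by positivity
  have hk1 : k ≤ 1 := inv_le_one_of_one_le₀ hκ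
  have hkτ : k / 2 ≤ τ := by
    rw [hk, div_le_iff₀ two_pos, inv_le_iff_one_le_mul₀ (by positivity)]; linarith
  have hημ' : η * μ = 1 / (4 * τ * √(L / μ) ^ 2) := by
    rw [hκ2]
    rw [hηdef]; field_simp
  have hημ : η * μ ≤ 1 / 2 := by
    rw [hημ', div_le_div_iff₀ (by positivity) two_pos]; nlinarith
  have hημk : k / 4 ≤ η * μ := by
    rw [hημ', hk, div_le_div_iff₀ (by norm_num) (by positivity), inv_mul_eq_div,
      div_le_iff₀ (by positivity)]
    nlinarith
  have hτρ : k / 48 ≤ τ * gossipGap M ^ 2 / 6 := by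
    have : k / 2 * (1 / 4) ≤ τ * gossipGap M ^ 2 := by gcongr
    linarith
  induction t with
  | zero => exact ⟨by simp [opapc], u₀, by simp [opapc, hu], by simp [opapc]⟩
  | succ t ih =>
    obtain ⟨hr, u, hy, hV⟩ := ih
    have hstep : opapc L μ M f x₀ y₀ (t + 1) = opapcStep L μ M f (opapc L μ M f x₀ y₀ t) := by
      rw [opapc, Function.iterate_succ_apply']; rfl
    rw [hstep]
    set st := opapc L μ M f x₀ y₀ t with hst
    set g := τ • st.x + (1 - τ) • st.xf with hgdef
    set w := (1 + η * μ)⁻¹ • (st.x - η • (nodewise (fun i => ∇ (f i)) g - μ • g + st.y)) with hw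
    have hynew : (opapcStep L μ M f st).y =
        -nodewise (fun i => ∇ (f i)) z + gossipPrecond M (u + η⁻¹ • w) := by
      change st.y + opapcTheta L μ M • acceleratedGossip M w = _
      rw [opapcTheta_smul hχ, hy, map_add, add_assoc]
    refine ⟨?_, u + η⁻¹ • w, hynew, ?_⟩
    · change st.rounds + gossipRounds M w = _
      rw [hr, gossipRounds_eq (one_le_gossipLength hχ)]
      ring
    · have hxnew : (opapcStep L μ M f st).x = (1 + η * μ)⁻¹ • (st.x - η •
          (nodewise (fun i => ∇ (f i)) g - μ • g + (opapcStep L μ M f st).y)) := rfl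
      have hfnew : (opapcStep L μ M f st).xf =
        g + (2 * τ / (2 - τ)) • ((opapcStep L μ M f st).x - st.x) := rfl
      rw [hynew] at hxnew
      rw [hy] at hw
      have := opapcEnergy_step (r := 1 / (50 * √(L / μ))) (hF.sub_sq hμ.le)
        (isPreconditioner_gossipPrecond hM hχ) hL hμ (sq_nonneg _) hτ hτ1 hη hημ
        (by rw [hkdef]; exact one_le_one_sub_mul hk0.le hk1 (by linarith))
        (by rw [hkdef]; exact one_le_one_sub_mul hk0.le hk1 hτρ)
        (by rw [hkdef]; linarith) z st.x st.xf u _ _ g w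
        (-nodewise (fun i => ∇ (f i)) z) (gossipPrecond_apply_of_ker hχ hz) (by abel)
        hgdef hw hxnew hfnew
      rw [pow_succ' (1 - _) t, mul_assoc]
      refine this.trans (mul_le_mul_of_nonneg_left hV ?_)
      rw [hkdef]; linarith

/-- Complexity of OPAPC for a general communication matrix; the hypotheses on `z` are those of
`msdaComplexity_of_optimal`. -/
theorem opapcComplexity_of_optimal (hμ : 0 < μ) (hμL : μ ≤ L) (hM : M.PosSemidef)
    (hχ : 1 < condNumber M) {D : ℝ} (hD : sqrtChi M ≤ D)
    (hf : ∀ i, LSmooth L (f i)) (hc : ∀ i, StrongConvexOn Set.univ μ (f i))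
    (hz : M.toEuclideanLin z = 0)
    (hopt : ∀ w, M.toEuclideanLin w = 0 → inner ℝ w (nodewise (fun i => ∇ (f i)) z) = 0) :
    OPAPCComplexity L μ M f z (202 * √(L / μ) * D) := by
  intro x₀ y₀ hy₀ R ε hR hε hεR
  have hL : 0 < L := by linarith
  have hκ : 1 ≤ √(L / μ) := by rwa [Real.one_le_sqrt, one_le_div hμ]
  have hκ2 : √(L / μ) ^ 2 = L / μ := Real.sq_sqrt (by positivity)
  have hg := half_le_gossipGap hχ
  have hg1 := gossipGap_lt_one hχ
  have hgap : 1 / 4 ≤ gossipGap M ^ 2 := by nlinarith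
  have hgap1 : gossipGap M ^ 2 ≤ 1 := by nlinarith
  have hF := SmoothStrong.stackedSum fun i => (hf i).smoothStrong (hc i)
  have hP := isPreconditioner_gossipPrecond hM hχ
  have hperp : ∀ w, M.toEuclideanLin w = 0 →
      inner ℝ w (y₀ + nodewise (fun i => ∇ (f i)) z) = 0 := by
    intro w hw
    obtain ⟨v, rfl⟩ := hy₀
    rw [inner_add_right, hopt w hw, ← inner_toEuclideanLin hM.isHermitian, hw, inner_zero_left,
      add_zero]
  obtain ⟨u, hu⟩ := exists_gossipPrecond_eq hM hχ hperp
  have hH := hF.sub_sq hμ.le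
  refine reachesWithin_of_linear (K := gossipLength M) hκ
    ((Nat.floor_le (Real.sqrt_nonneg _)).trans hD) hε hεR
    (fun t => (opapc_invariant hμ hμL hM hχ hF hz x₀ y₀ u hu t).1) fun t => ?_
  obtain ⟨-, u', -, hV⟩ := opapc_invariant hμ hμL hM hχ hF hz x₀ y₀ u hu t
  obtain ⟨hτ, hτ2, -, hτ1⟩ := opapcTau_bounds hμ hμL hχ
  set τ := opapcTau L μ M with hτdef
  have hηdef : opapcEta L μ M = 1 / (4 * τ * L) := rfl
  set η := opapcEta L μ M
  have hη0 : 0 < η := by rw [hηdef]; positivity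
  have hημ : η * μ ≤ 1 / 2 := by
    have h1 : η * μ = 1 / (4 * τ * √(L / μ) ^ 2) := by rw [hηdef, hκ2]; field_simp
    rw [h1, div_le_div_iff₀ (by positivity) two_pos]; nlinarith
  have hτL : μ ≤ 4 * τ ^ 2 * L := by
    have h1 := pow_le_pow_left₀ zero_le_one hτ2 2
    rw [mul_pow, mul_pow, hκ2] at h1
    calc μ = 1 ^ 2 * μ := by ring
      _ ≤ 2 ^ 2 * (L / μ) * τ ^ 2 * μ := by gcongr
      _ = _ := by field_simp; norm_num
  have hlow := norm_sq_le_opapcEnergy hH hP hμ (sq_nonneg _) hτ hτ1 hη0 z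
    (opapc L μ M f x₀ y₀ t).x (opapc L μ M f x₀ y₀ t).xf u'
  have hup := opapcEnergy_init_le hH hP hμ hμL hgap hgap1 hτ hτ1 hτL
    (by rw [hηdef]; field_simp) hημ z x₀ u
  rw [hu] at hup
  replace hup := hup.trans (mul_le_mul_of_nonneg_left hR (by norm_num))
  have hrate : 0 ≤ (1 - 1 / (50 * √(L / μ))) ^ t := by
    refine pow_nonneg ?_ t
    rw [sub_nonneg, div_le_one (by positivity)]; linarith
  have hR0 : 0 < R := by linarith
  calc _ ≤ _ := hlow.trans hV
    _ ≤ (1 - 1 / (50 * √(L / μ))) ^ t * (3 * R) := by gcongr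
    _ ≤ (1 - 1 / (50 * √(L / μ))) ^ t * (8 * R) := by gcongr; norm_num
    _ = _ := by ring

end Methods

/-! ### Condition numbers from quadratic forms -/

section Spectral

variable {ι : Type*} [Fintype ι] [DecidableEq ι] {M : Matrix ι ι ℝ}

/-- A symmetric matrix with a single nonzero eigenvalue is a multiple of a projection. -/
theorem mul_self_apply_of_eigenvalues (hM : M.IsHermitian) {t : ℝ}
    (h : ∀ i, hM.eigenvalues i = 0 ∨ hM.eigenvalues i = t) (p q : ι) :
    (M * M) p q = t * M p q := by
  have h1 : M.toEuclideanLin ∘ₗ M.toEuclideanLin = t • M.toEuclideanLin := by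
    refine hM.eigenvectorBasis.toBasis.ext fun i => ?_
    rw [OrthonormalBasis.coe_toBasis, LinearMap.comp_apply, LinearMap.smul_apply,
      toEuclideanLin_eigenvectorBasis, map_smul, toEuclideanLin_eigenvectorBasis]
    rcases h i with h | h <;> simp [h]
  have h2 := congrArg (fun v : EuclideanSpace ℝ ι => v p)
    (LinearMap.congr_fun h1 (EuclideanSpace.single q 1))
  have h3 : (M * M).mulVec (Pi.single q 1) p = t * M.mulVec (Pi.single q 1) p := by
    rw [← Matrix.mulVec_mulVec]
    exact h2
  simpa using h3

/-- The extreme positive eigenvalues are attained and differ, if `M` is not a multiple of a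
projection. The test is on the entries: some entry of `M * M` is positive where `M` vanishes. -/
theorem spectrum_gap_of_entries (hM : M.PosSemidef) (hoff : ∀ i j, i ≠ j → M i j ≤ 0) {p q r : ι}
    (hpq : M p q = 0) (hpr : M p r ≠ 0) (hrq : M r q ≠ 0) :
    lambdaMax M ∈ spectrum ℝ M ∧ lambdaMinPos M ∈ spectrum ℝ M ∧ 0 < lambdaMinPos M ∧
      lambdaMinPos M < lambdaMax M := by
  have hspec := hM.isHermitian.spectrum_real_eq_range_eigenvalues
  have hfin : (spectrum ℝ M).Finite := by rw [hspec]; exact Set.finite_range _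
  have hpos : 0 < (M * M) p q := by
    rw [Matrix.mul_apply]
    have hrp : r ≠ p := by rintro rfl; exact hrq hpq
    have hrq' : r ≠ q := by rintro rfl; exact hpr hpq
    refine Finset.sum_pos' (fun s _ => ?_) ⟨r, Finset.mem_univ _, ?_⟩
    · rcases eq_or_ne s p with rfl | h1
      · simp [hpq]
      rcases eq_or_ne s q with rfl | h2
      · simp [hpq]
      exact mul_nonneg_of_nonpos_of_nonpos (hoff _ _ h1.symm) (hoff _ _ h2)
    · exact mul_pos_of_neg_of_neg (lt_of_le_of_ne (hoff _ _ hrp.symm) hpr)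
        (lt_of_le_of_ne (hoff _ _ hrq') hrq)
  have hne : {t : ℝ | t ∈ spectrum ℝ M ∧ 0 < t}.Nonempty := by
    by_contra hempty
    have h0 : ∀ i, hM.isHermitian.eigenvalues i = 0 ∨ hM.isHermitian.eigenvalues i = 0 := by
      intro i
      rcases (hM.eigenvalues_nonneg i).eq_or_lt' with h | h
      · exact Or.inl h
      · exact absurd ⟨_, by rw [hspec]; exact ⟨i, rfl⟩, h⟩ hempty
    rw [mul_self_apply_of_eigenvalues hM.isHermitian h0, hpq, mul_zero] at hpos
    exact hpos.false
  have hmin := hne.csInf_mem (hfin.subset fun t ht => ht.1)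
  have hmax : lambdaMax M ∈ spectrum ℝ M :=
    Set.Nonempty.csSup_mem (hne.mono fun t ht => ht.1) hfin
  refine ⟨hmax, hmin.1, hmin.2, lt_of_le_of_ne (le_csSup hfin.bddAbove hmin.1) fun heq => ?_⟩
  have h0 : ∀ i, hM.isHermitian.eigenvalues i = 0 ∨
      hM.isHermitian.eigenvalues i = lambdaMax M := by
    intro i
    rcases eigenvalues_eq_zero_or_mem hM i with h | h
    · exact Or.inl h
    · exact Or.inr (le_antisymm h.2 (heq ▸ h.1))
  rw [mul_self_apply_of_eigenvalues hM.isHermitian h0, hpq, mul_zero] at hpos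
  exact hpos.false

/-- Bounds for the positive eigenvalues: above by the quadratic form, below by the distance to
the kernel, which is at least the norm for an eigenvector, as it is orthogonal to the kernel. -/
theorem mem_Icc_of_mem_spectrum (hM : M.PosSemidef) {a b t : ℝ}
    (hupper : ∀ x, inner ℝ x (M.toEuclideanLin x) ≤ b * ‖x‖ ^ 2)
    (hlower : ∀ x, ∃ z, M.toEuclideanLin z = 0 ∧
      a * ‖x - z‖ ^ 2 ≤ inner ℝ x (M.toEuclideanLin x)) (ha : 0 ≤ a)
    (ht : t ∈ spectrum ℝ M) (ht0 : 0 < t) : a ≤ t ∧ t ≤ b := by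
  rw [hM.isHermitian.spectrum_real_eq_range_eigenvalues] at ht
  obtain ⟨i, rfl⟩ := ht
  set v := hM.isHermitian.eigenvectorBasis i with hv
  set t := hM.isHermitian.eigenvalues i with ht
  have hev : M.toEuclideanLin v = t • v := toEuclideanLin_eigenvectorBasis hM.isHermitian i
  have hn : ‖v‖ = 1 := hM.isHermitian.eigenvectorBasis.orthonormal.1 i
  have hq : inner ℝ v (M.toEuclideanLin v) = t := by
    rw [hev, inner_smul_right, real_inner_self_eq_norm_sq, hn]; ring
  constructor
  · obtain ⟨z, hz, h⟩ := hlower v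
    have hvz : inner ℝ v z = 0 := by
      have h1 := inner_toEuclideanLin hM.isHermitian v z
      rw [hz, inner_zero_right, hev, inner_smul_left, RCLike.conj_to_real] at h1
      exact (mul_eq_zero.1 h1).resolve_left ht0.ne'
    rw [hq, norm_sub_sq_real, hvz, hn] at h
    nlinarith [sq_nonneg ‖z‖]
  · have h := hupper v
    rw [hq, hn] at h
    linarith

end Spectral

/-! ### Both methods on a general network -/

section Network

variable {V : Type*} [Fintype V] [DecidableEq V]
  {S : V → Type*} [∀ i, Fintype (S i)] [∀ i, DecidableEq (S i)]
  {L μ : ℝ} {M : Matrix (Σ i, S i) (Σ i, S i) ℝ} {f : ∀ i, EuclideanSpace ℝ (S i) → ℝ}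

/-- Complexity of both methods when the consensus vectors are the image of a linear map `stack`,
the communication matrix is bounded above by `b` and below by `a` away from the consensus
vectors. -/
theorem complexity_of_stack {n : ℕ} (hM : M.PosSemidef) (hoff : ∀ i j, i ≠ j → M i j ≤ 0)
    {p q r : Σ i, S i} (hpq : M p q = 0) (hpr : M p r ≠ 0) (hrq : M r q ≠ 0)
    (stack : EuclideanSpace ℝ (Fin n) →ₗ[ℝ] EuclideanSpace ℝ (Σ i, S i))
    (hnorm : ∀ x, ‖x‖ ≤ ‖stack x‖) (hker : ∀ x, M.toEuclideanLin (stack x) = 0) {a b D : ℝ}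
    (ha : 0 < a) (hupper : ∀ x, inner ℝ x (M.toEuclideanLin x) ≤ b * ‖x‖ ^ 2)
    (hlower : ∀ x, ∃ w, a * ‖x - stack w‖ ^ 2 ≤ inner ℝ x (M.toEuclideanLin x))
    (hD : √(b / a) ≤ D) (hμ : 0 < μ)
    (hf : ∀ i, LSmooth L (f i)) (hc : ∀ i, StrongConvexOn Set.univ μ (f i)) :
    ∃ xStar, IsMinOn (fun x => stackedSum f (stack x)) Set.univ xStar ∧
      MSDAComplexity L μ M f (stack xStar) (202 * √(L / μ) * D) ∧
      OPAPCComplexity L μ M f (stack xStar) (202 * √(L / μ) * D) := by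
  have hF := SmoothStrong.stackedSum fun i => (hf i).smoothStrong (hc i)
  have hcont : Continuous (stackedSum f) :=
    continuous_finsetSum _ fun i _ => (hf i).1.continuous.comp (continuous_nodePart i)
  have hne : Nonempty (Σ i, S i) := ⟨p⟩
  have hμL : μ ≤ L := hF.le
  obtain ⟨hmax, hmin, hmin0, hlt⟩ := spectrum_gap_of_entries hM hoff hpq hpr hrq
  have hχ : 1 < condNumber M := by rwa [condNumber, one_lt_div hmin0]
  have hlower' : ∀ x, ∃ z, M.toEuclideanLin z = 0 ∧
      a * ‖x - z‖ ^ 2 ≤ inner ℝ x (M.toEuclideanLin x) := fun x =>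
    let ⟨w, hw⟩ := hlower x
    ⟨stack w, hker w, hw⟩
  have hsqrt : sqrtChi M ≤ D := by
    refine (Real.sqrt_le_sqrt ?_).trans hD
    have h1 := (mem_Icc_of_mem_spectrum hM hupper hlower' ha.le hmin hmin0).1
    have h2 := (mem_Icc_of_mem_spectrum hM hupper hlower' ha.le hmax (hmin0.trans hlt)).2
    have h3 : 0 ≤ b := (hmin0.trans hlt).le.trans h2
    rw [condNumber]
    gcongr
  obtain ⟨xStar, hx⟩ := hF.exists_isMinOn hμ hcont stack
    stack.continuous_of_finiteDimensional hnorm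
  -- the kernel consists of the stacked vectors, so minimality over them gives orthogonality
  have hopt : ∀ w, M.toEuclideanLin w = 0 →
      inner ℝ w (nodewise (fun i => ∇ (f i)) (stack xStar)) = 0 := by
    intro w hw
    obtain ⟨v, hv⟩ := hlower w
    rw [hw, inner_zero_right] at hv
    have h1 : w = stack v := by
      have h2 : ‖w - stack v‖ ^ 2 = 0 := le_antisymm (by nlinarith) (sq_nonneg _)
      exact sub_eq_zero.1 (norm_eq_zero.1 (pow_eq_zero_iff two_ne_zero |>.1 h2))
    rw [real_inner_comm, h1]
    refine hF.inner_eq_zero fun t => ?_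
    have := hx (Set.mem_univ (xStar + t • v))
    simpa using this
  exact ⟨xStar, hx, msdaComplexity_of_optimal hμ hμL hM hχ hsqrt hf hc (hker _) hopt,
    opapcComplexity_of_optimal hμ hμL hM hχ hsqrt hf hc (hker _) hopt⟩

end Network

/-! ### Graph Laplacians acting on stacked vectors -/

section Column

variable {V κ : Type*} {n : ℕ} {e : κ → V × Fin n}

/-- The values of the variable `l` in a stacked vector with coordinates `e`, extended by zero to
the nodes that do not store this variable. -/
noncomputable def column (e : κ → V × Fin n) (x : κ → ℝ) (l : Fin n) (v : V) : ℝ :=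
  Function.extend e x 0 (v, l)

theorem column_apply (he : e.Injective) (x : κ → ℝ) (p : κ) :
    column e x (e p).2 (e p).1 = x p :=
  he.extend_apply x 0 p

theorem column_of_notMem (x : κ → ℝ) {l : Fin n} {v : V} (h : (v, l) ∉ Set.range e) :
    column e x l v = 0 :=
  Function.extend_apply' _ _ _ h

variable [Fintype V] [DecidableEq V]

theorem lapMatrix_apply_of_ne (Γ : SimpleGraph V) [DecidableRel Γ.Adj] {u v : V} (h : u ≠ v) :
    Γ.lapMatrix ℝ u v = if Γ.Adj u v then -1 else 0 := by
  simp only [SimpleGraph.lapMatrix, SimpleGraph.degMatrix, Matrix.sub_apply,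
    Matrix.diagonal_apply_ne _ h, SimpleGraph.adjMatrix_apply]
  split_ifs <;> simp

variable {Γ : Fin n → SimpleGraph V} [∀ l, DecidableRel (Γ l).Adj] {M : Matrix κ κ ℝ}

theorem apply_nonpos_of_lapMatrix (he : e.Injective)
    (hM : ∀ p q, M p q =
      if (e p).2 = (e q).2 then (Γ (e p).2).lapMatrix ℝ (e p).1 (e q).1 else 0)
    (p q : κ) (hpq : p ≠ q) : M p q ≤ 0 := by
  rw [hM]
  split_ifs with h
  · rw [lapMatrix_apply_of_ne _ fun h' => hpq (he (Prod.ext h' h))]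
    split_ifs <;> simp
  · rfl

end Column

section Laplacian

variable {V : Type*} [Fintype V]

/-- The Dirichlet energy of a function on the nodes of a graph; every edge is counted once. -/
noncomputable def dirichlet (Γ : SimpleGraph V) [DecidableRel Γ.Adj] (X : V → ℝ) : ℝ :=
  (∑ u, ∑ v, if Γ.Adj u v then (X u - X v) ^ 2 else 0) / 2

theorem dirichlet_le (Γ : SimpleGraph V) [DecidableRel Γ.Adj] {d : ℕ} (hd : ∀ u, Γ.degree u ≤ d)
    (X : V → ℝ) : dirichlet Γ X ≤ 2 * d * ∑ u, X u ^ 2 := by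
  have hdeg : ∀ u, (∑ v, if Γ.Adj u v then X u ^ 2 else 0) ≤ d * X u ^ 2 := by
    intro u
    rw [← Finset.sum_filter, Finset.sum_const, nsmul_eq_mul, ← SimpleGraph.neighborFinset_eq_filter,
      SimpleGraph.card_neighborFinset_eq_degree]
    gcongr
    exact hd u
  have hsymm : (∑ u, ∑ v, if Γ.Adj u v then X v ^ 2 else 0) =
      ∑ u, ∑ v, if Γ.Adj u v then X u ^ 2 else 0 := by
    rw [Finset.sum_comm]
    simp_rw [Γ.adj_comm]
  have h1 : (∑ u, ∑ v, if Γ.Adj u v then (X u - X v) ^ 2 else 0) ≤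
      2 * ((∑ u, ∑ v, if Γ.Adj u v then X u ^ 2 else 0) +
        ∑ u, ∑ v, if Γ.Adj u v then X v ^ 2 else 0) := by
    rw [← Finset.sum_add_distrib, Finset.mul_sum]
    refine Finset.sum_le_sum fun u _ => ?_
    rw [← Finset.sum_add_distrib, Finset.mul_sum]
    refine Finset.sum_le_sum fun v _ => ?_
    split_ifs
    · nlinarith [sq_nonneg (X u + X v)]
    · simp
  have h2 : (∑ u, ∑ v, if Γ.Adj u v then X u ^ 2 else 0) ≤ d * ∑ u, X u ^ 2 := by
    rw [Finset.mul_sum]; exact Finset.sum_le_sum fun u _ => hdeg u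
  rw [hsymm] at h1
  unfold dirichlet
  linarith

/-- If every node is moved along an edge or not at all, the squared increments are bounded by
the energy. -/
theorem sum_sq_sub_le_dirichlet (Γ : SimpleGraph V) [DecidableRel Γ.Adj] (φ : V → V)
    (hφ : ∀ u, φ u = u ∨ Γ.Adj u (φ u)) (X : V → ℝ) :
    ∑ u, (X u - X (φ u)) ^ 2 ≤ 2 * dirichlet Γ X := by
  rw [dirichlet, mul_div_cancel₀ _ two_ne_zero]
  refine Finset.sum_le_sum fun u _ => ?_
  have h0 : ∀ v ∈ Finset.univ, 0 ≤ if Γ.Adj u v then (X u - X v) ^ 2 else 0 := by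
    intro v _; split_ifs <;> positivity
  rcases hφ u with h | h
  · rw [h, sub_self]
    simpa using Finset.sum_nonneg h0
  · have := Finset.single_le_sum h0 (Finset.mem_univ (φ u))
    rwa [if_pos h] at this

variable {κ : Type*} [Fintype κ] {n : ℕ} {e : κ → V × Fin n}

theorem sum_eq_sum_column (he : e.Injective) (g : V → Fin n → ℝ) (h : κ → ℝ)
    (h0 : ∀ v l, (v, l) ∉ Set.range e → g v l = 0) (h1 : ∀ p, h p = g (e p).1 (e p).2) :
    ∑ p, h p = ∑ l, ∑ v, g v l := by
  rw [Fintype.sum_of_injective e he h (fun a => g a.1 a.2) (fun a ha => h0 _ _ ha) h1,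
    Fintype.sum_prod_type_right]

theorem norm_sq_eq_sum_column (he : e.Injective) (x : EuclideanSpace ℝ κ) :
    ‖x‖ ^ 2 = ∑ l, ∑ v, column e x l v ^ 2 := by
  rw [EuclideanSpace.real_norm_sq_eq]
  exact sum_eq_sum_column he (fun v l => column e x l v ^ 2) _
    (fun v l h => by simp [column_of_notMem _ h]) fun p => by rw [column_apply he]

variable [DecidableEq κ] [DecidableEq V] {Γ : Fin n → SimpleGraph V} [∀ l, DecidableRel (Γ l).Adj]
  {M : Matrix κ κ ℝ}

/-- A matrix that acts on every variable `l` as the Laplacian of the graph `Γ l` has the sum of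
the Dirichlet energies as its quadratic form. -/
theorem inner_toEuclideanLin_eq_sum_dirichlet (he : e.Injective)
    (hM : ∀ p q, M p q =
      if (e p).2 = (e q).2 then (Γ (e p).2).lapMatrix ℝ (e p).1 (e q).1 else 0)
    (x : EuclideanSpace ℝ κ) :
    inner ℝ x (M.toEuclideanLin x) = ∑ l, dirichlet (Γ l) (column e x l) := by
  have h1 : ∀ l, dirichlet (Γ l) (column e x l) =
      ∑ u, column e x l u * ∑ v, (Γ l).lapMatrix ℝ u v * column e x l v := by
    intro l
    rw [dirichlet, ← SimpleGraph.lapMatrix_toLinearMap₂' ℝ (Γ l), Matrix.toLinearMap₂'_apply']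
    rfl
  have h2 : ∀ p, M.toEuclideanLin x p =
      ∑ v, (Γ (e p).2).lapMatrix ℝ (e p).1 v * column e x (e p).2 v := by
    intro p
    have h3 : M.toEuclideanLin x p = ∑ q, M p q * x q := rfl
    rw [h3, sum_eq_sum_column he (fun v l => if (e p).2 = l then
      (Γ (e p).2).lapMatrix ℝ (e p).1 v * column e x l v else 0)]
    · rw [Finset.sum_eq_single (e p).2]
      · simp
      · intro l _ hl; simp [hl.symm]
      · simp
    · intro v l h
      simp [column_of_notMem _ h]
    · intro q
      rw [hM, column_apply he]
      split_ifs <;> simp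
  simp_rw [h1]
  rw [real_inner_comm, PiLp.inner_apply]
  refine sum_eq_sum_column he (fun u l => column e x l u *
    ∑ v, (Γ l).lapMatrix ℝ u v * column e x l v) _ (fun v l h => ?_) fun p => ?_
  · simp [column_of_notMem _ h]
  · rw [column_apply he, ← h2]
    simp [mul_comm]

theorem posSemidef_of_lapMatrix (he : e.Injective)
    (hM : ∀ p q, M p q =
      if (e p).2 = (e q).2 then (Γ (e p).2).lapMatrix ℝ (e p).1 (e q).1 else 0) :
    M.PosSemidef := by
  have hH : M.IsHermitian := by
    ext p q
    rw [Matrix.conjTranspose_apply, star_trivial, hM, hM]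
    by_cases h : (e p).2 = (e q).2
    · rw [if_pos h, if_pos h.symm, ← h]
      exact ((Γ (e p).2).isSymm_lapMatrix (R := ℝ)).apply _ _
    · rw [if_neg h, if_neg (Ne.symm h)]
  refine Matrix.PosSemidef.of_dotProduct_mulVec_nonneg hH fun x => ?_
  have h1 := inner_toEuclideanLin_eq_sum_dirichlet he hM (WithLp.toLp 2 x)
  have h2 : inner ℝ (WithLp.toLp 2 x) (M.toEuclideanLin (WithLp.toLp 2 x)) =
      star x ⬝ᵥ M.mulVec x := by
    rw [PiLp.inner_apply]
    simp [dotProduct, mul_comm]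
  rw [← h2, h1]
  refine Finset.sum_nonneg fun l _ => ?_
  unfold dirichlet
  refine div_nonneg (Finset.sum_nonneg fun u _ => Finset.sum_nonneg fun v _ => ?_) two_pos.le
  split_ifs <;> positivity

/-- A vector whose columns are constant along the edges lies in the kernel. -/
theorem toEuclideanLin_eq_zero_of_lapMatrix (he : e.Injective)
    (hM : ∀ p q, M p q =
      if (e p).2 = (e q).2 then (Γ (e p).2).lapMatrix ℝ (e p).1 (e q).1 else 0)
    (x : EuclideanSpace ℝ κ)
    (hx : ∀ l u v, (Γ l).Adj u v → column e x l u = column e x l v) :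
    M.toEuclideanLin x = 0 := by
  have h1 : inner ℝ x (M.toEuclideanLin x) = 0 := by
    rw [inner_toEuclideanLin_eq_sum_dirichlet he hM]
    refine Finset.sum_eq_zero fun l _ => ?_
    rw [dirichlet, div_eq_zero_iff]
    refine Or.inl (Finset.sum_eq_zero fun u _ => Finset.sum_eq_zero fun v _ => ?_)
    split_ifs with h
    · rw [hx l u v h]; simp
    · rfl
  have h2 : star x.ofLp ⬝ᵥ M.mulVec x.ofLp = inner ℝ x (M.toEuclideanLin x) := by
    rw [PiLp.inner_apply]
    simp [dotProduct, mul_comm, Matrix.toLpLin_apply]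
  have h3 := ((posSemidef_of_lapMatrix he hM).dotProduct_mulVec_zero_iff x.ofLp).1 (h2.trans h1)
  ext p
  exact congrFun h3 p

end Laplacian

/-! ### The cycle of cliques -/

section Ring

theorem ringOfCliques_degree_le (m j : ℕ) [DecidableRel (ringOfCliques (m + 3) (j + 2)).Adj]
    (u : Fin (m + 3) × Fin (j + 2)) : (ringOfCliques (m + 3) (j + 2)).degree u ≤ j + 4 := by
  have hsub : (ringOfCliques (m + 3) (j + 2)).neighborFinset u ⊆
      ({u.1} ×ˢ Finset.univ) ∪ ((SimpleGraph.cycleGraph (m + 3)).neighborFinset u.1 ×ˢ {0}) := by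
    intro v hv
    rw [SimpleGraph.mem_neighborFinset] at hv
    rw [Finset.mem_union, Finset.mem_product, Finset.mem_product]
    rcases hv with h | h
    · exact Or.inl ⟨by simp [h.1], Finset.mem_univ _⟩
    · refine Or.inr ⟨by simpa using h.2.2, ?_⟩
      rw [Finset.mem_singleton]
      exact Fin.ext h.2.1
  have hcard := (Finset.card_le_card hsub).trans (Finset.card_union_le _ _)
  rw [SimpleGraph.card_neighborFinset_eq_degree, Finset.card_product, Finset.card_product,
    SimpleGraph.card_neighborFinset_eq_degree, SimpleGraph.cycleGraph_degree_three_le] at hcard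
  simp at hcard
  omega

open Fin.NatCast in
/-- Telescoping along the path `0, …, c` of the cycle, and the Cauchy–Schwarz inequality. -/
theorem sq_sub_le_sum_cycle (m : ℕ) (Y : Fin (m + 3) → ℝ) (c : Fin (m + 3)) :
    (Y c - Y 0) ^ 2 ≤ (m + 3) * ∑ i, (Y i - Y (i + 1)) ^ 2 := by
  set y : ℕ → ℝ := fun i => Y (i : Fin (m + 3)) with hy
  have h1 : Y c - Y 0 = ∑ i ∈ Finset.range c, (y (i + 1) - y i) := by
    rw [Finset.sum_range_sub]
    simp [hy]
  have h2 : ∑ i, (Y i - Y (i + 1)) ^ 2 = ∑ i ∈ Finset.range (m + 3), (y (i + 1) - y i) ^ 2 := by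
    rw [Finset.sum_range]
    refine Finset.sum_congr rfl fun i _ => ?_
    simp only [hy, Nat.cast_add, Nat.cast_one, Fin.cast_val_eq_self]
    ring
  have h3 : ∑ i ∈ Finset.range c, (y (i + 1) - y i) ^ 2 ≤
      ∑ i ∈ Finset.range (m + 3), (y (i + 1) - y i) ^ 2 :=
    Finset.sum_le_sum_of_subset_of_nonneg (Finset.range_mono c.2.le) fun _ _ _ => sq_nonneg _
  have h4 : (c : ℝ) ≤ m + 3 := by exact_mod_cast c.2.le
  rw [h1, h2]
  refine sq_sum_le_card_mul_sum_sq.trans ?_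
  rw [Finset.card_range]
  gcongr

/-- Poincaré inequality for the cycle of cliques, anchored at one node: every node reaches the
cycle by at most one edge, and the cycle has length `m + 3`. -/
theorem ringOfCliques_poincare (m j : ℕ) [DecidableRel (ringOfCliques (m + 3) (j + 2)).Adj]
    (X : Fin (m + 3) × Fin (j + 2) → ℝ) :
    ∑ v, (X v - X (0, 0)) ^ 2 ≤
      5 * ((m + 3) ^ 2 * (j + 2)) * dirichlet (ringOfCliques (m + 3) (j + 2)) X := by
  set E := dirichlet (ringOfCliques (m + 3) (j + 2)) X
  have h1 : ∑ u : Fin (m + 3) × Fin (j + 2), (X u - X (u.1, 0)) ^ 2 ≤ 2 * E := by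
    refine sum_sq_sub_le_dirichlet _ (fun u => (u.1, 0)) (fun u => ?_) X
    by_cases h : u.2 = 0
    · exact Or.inl (Prod.ext rfl h.symm)
    · exact Or.inr (Or.inl ⟨rfl, h⟩)
  have h2 : ∑ u : Fin (m + 3) × Fin (j + 2),
      (X u - X (if u.2 = 0 then (u.1 + 1, 0) else u)) ^ 2 ≤ 2 * E := by
    refine sum_sq_sub_le_dirichlet _ (fun u => if u.2 = 0 then (u.1 + 1, 0) else u) (fun u => ?_) X
    by_cases h : u.2 = 0
    · refine Or.inr ?_
      simp only [h, if_true]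
      refine Or.inr ⟨by simp [h], rfl, ?_⟩
      rw [SimpleGraph.cycleGraph_adj]
      exact Or.inr (by simp)
    · exact Or.inl (if_neg h)
  have h3 : ∑ c : Fin (m + 3), (X (c, 0) - X (c + 1, 0)) ^ 2 ≤ 2 * E := by
    refine le_trans ?_ h2
    rw [Fintype.sum_prod_type]
    refine Finset.sum_le_sum fun c _ => ?_
    have := Finset.single_le_sum (f := fun i : Fin (j + 2) =>
      (X (c, i) - X (if i = 0 then (c + 1, 0) else (c, i))) ^ 2)
      (fun _ _ => sq_nonneg _) (Finset.mem_univ 0)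
    simpa using this
  have h4 : ∀ u : Fin (m + 3) × Fin (j + 2), (X (u.1, 0) - X (0, 0)) ^ 2 ≤ (m + 3) * (2 * E) :=
    fun u => (sq_sub_le_sum_cycle m (fun c => X (c, 0)) u.1).trans (by gcongr)
  have h5 : ∑ u : Fin (m + 3) × Fin (j + 2), (X (u.1, 0) - X (0, 0)) ^ 2 ≤
      ((m + 3) * (j + 2)) * ((m + 3) * (2 * E)) := by
    refine (Finset.sum_le_sum fun u _ => h4 u).trans_eq ?_
    simp
  have hE : 0 ≤ E := by
    have : 0 ≤ 2 * E := le_trans (Finset.sum_nonneg fun _ _ => sq_nonneg _) h1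
    linarith
  have h6 : ∑ v, (X v - X (0, 0)) ^ 2 ≤
      2 * ∑ u : Fin (m + 3) × Fin (j + 2), (X u - X (u.1, 0)) ^ 2 +
      2 * ∑ u : Fin (m + 3) × Fin (j + 2), (X (u.1, 0) - X (0, 0)) ^ 2 := by
    rw [Finset.mul_sum, Finset.mul_sum, ← Finset.sum_add_distrib]
    refine Finset.sum_le_sum fun u _ => ?_
    nlinarith [sq_nonneg ((X u - X (u.1, 0)) - (X (u.1, 0) - X (0, 0)))]
  have h7 : (4 : ℝ) ≤ (m + 3) ^ 2 * (j + 2) := by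
    have hm : (0 : ℝ) ≤ m := m.cast_nonneg
    have hj : (0 : ℝ) ≤ j := j.cast_nonneg
    calc (4 : ℝ) ≤ (0 + 3) ^ 2 * (0 + 2) := by norm_num
      _ ≤ _ := by gcongr
  nlinarith [mul_le_mul_of_nonneg_right h7 hE]

/-- A stacked vector that contains every coordinate of `x` is at least as long as `x`. -/
theorem norm_le_of_section {κ : Type*} [Fintype κ] {n : ℕ} (x : EuclideanSpace ℝ (Fin n))
    (idx : κ → Fin n) (s : Fin n → κ) (hs : ∀ l, idx (s l) = l) :
    ‖x‖ ≤ ‖(WithLp.toLp 2 fun p => x (idx p) : EuclideanSpace ℝ κ)‖ := by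
  rw [EuclideanSpace.norm_eq, EuclideanSpace.norm_eq]
  refine Real.sqrt_le_sqrt ?_
  have hinj : s.Injective := fun a b h => by rw [← hs a, h, hs]
  calc ∑ l, ‖x l‖ ^ 2 = ∑ p ∈ Finset.univ.map ⟨s, hinj⟩, ‖x (idx p)‖ ^ 2 := by simp [hs]
    _ ≤ _ := Finset.sum_le_univ_sum_of_nonneg fun _ => sq_nonneg _

theorem norm_le_stackFull {V : Type*} [Fintype V] {n : ℕ} (v : V) (x : EuclideanSpace ℝ (Fin n)) :
    ‖x‖ ≤ ‖stackFull V x‖ :=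
  norm_le_of_section x (fun p : (Σ _ : V, Fin n) => p.2) (fun l => ⟨v, l⟩) fun _ => rfl

theorem norm_le_stackPartitioned {V : Type*} [Fintype V] {n : ℕ} {N : V → Finset (Fin n)}
    {c : Fin n → V} (hc : ∀ l, l ∈ N (c l)) (x : EuclideanSpace ℝ (Fin n)) :
    ‖x‖ ≤ ‖stackPartitioned N x‖ :=
  norm_le_of_section x (fun p : (Σ i : V, N i) => p.2.1) (fun l => ⟨c l, l, hc l⟩) fun _ => rfl

/-- The copying of a vector to all nodes, as a linear map. -/
def stackFullLin (V : Type*) [Fintype V] (n : ℕ) :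
    EuclideanSpace ℝ (Fin n) →ₗ[ℝ] EuclideanSpace ℝ (Σ _ : V, Fin n) where
  toFun := stackFull V
  map_add' _ _ := rfl
  map_smul' _ _ := rfl

/-- The distribution of the coordinates of a vector to the nodes that store them, as a linear
map. -/
def stackPartitionedLin {V : Type*} {n : ℕ} (N : V → Finset (Fin n)) :
    EuclideanSpace ℝ (Fin n) →ₗ[ℝ] EuclideanSpace ℝ (Σ i : V, N i) where
  toFun := stackPartitioned N
  map_add' _ _ := rfl
  map_smul' _ _ := rfl

open Classical in
theorem laplacianGossip_apply {V : Type*} [Fintype V] [DecidableEq V] (G : SimpleGraph V) (n : ℕ)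
    (p q : Σ _ : V, Fin n) :
    laplacianGossip G n p q = if p.2 = q.2 then G.lapMatrix ℝ p.1 q.1 else 0 := by
  simp only [laplacianGossip, Matrix.submatrix_apply, Matrix.kroneckerMap_apply, Matrix.one_apply,
    mul_ite, mul_one, mul_zero]

open Classical in
theorem partitionedGossip_apply {V : Type*} [Fintype V] [DecidableEq V] {n : ℕ}
    (G : SimpleGraph V) (N : V → Finset (Fin n)) (p q : Σ i : V, N i) :
    partitionedGossip G N p q = if p.2.1 = q.2.1 then
      (variableGraph G N p.2.1).lapMatrix ℝ p.1 q.1 else 0 := by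
  simp only [partitionedGossip, partitionedMatrix, Matrix.submatrix_apply, Matrix.sum_apply,
    Matrix.kroneckerMap_apply, Matrix.single_apply]
  rw [Finset.sum_eq_single p.2.1]
  · simp
  · intro l _ hl; simp [hl]
  · simp

theorem full_injective (V : Type*) (n : ℕ) :
    Function.Injective fun p : (Σ _ : V, Fin n) => (p.1, p.2) := by
  rintro ⟨a, b⟩ ⟨c, d⟩ h
  simp only [Prod.mk.injEq] at h
  obtain ⟨rfl, rfl⟩ := h
  rfl

theorem partitioned_injective {V : Type*} {n : ℕ} (N : V → Finset (Fin n)) :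
    Function.Injective fun p : (Σ i : V, N i) => (p.1, p.2.1) := by
  rintro ⟨a, b⟩ ⟨c, d⟩ h
  simp only [Prod.mk.injEq] at h
  obtain ⟨rfl, h⟩ := h
  rw [Subtype.ext h]

open Classical in
/-- Both methods with the Laplacian of the cycle of `m + 3` cliques of size `j + 2`. -/
theorem complexity_laplacianGossip (m j : ℕ) {L μ : ℝ} (hμ : 0 < μ)
    {f : Fin (m + 3) × Fin (j + 2) → EuclideanSpace ℝ (Fin (m + 3)) → ℝ}
    (hf : ∀ i, LSmooth L (f i)) (hc : ∀ i, StrongConvexOn Set.univ μ (f i)) :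
    ∃ xStar : EuclideanSpace ℝ (Fin (m + 3)),
      IsMinOn (fun x => ∑ i, f i x) Set.univ xStar ∧
      MSDAComplexity L μ (laplacianGossip (ringOfCliques (m + 3) (j + 2)) (m + 3)) f
        (stackFull (Fin (m + 3) × Fin (j + 2)) xStar)
        (202 * √(L / μ) * (5 * ((m + 3) * (j + 2)))) ∧
      OPAPCComplexity L μ (laplacianGossip (ringOfCliques (m + 3) (j + 2)) (m + 3)) f
        (stackFull (Fin (m + 3) × Fin (j + 2)) xStar)
        (202 * √(L / μ) * (5 * ((m + 3) * (j + 2)))) := by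
  set G := ringOfCliques (m + 3) (j + 2) with hG
  have he := full_injective (Fin (m + 3) × Fin (j + 2)) (m + 3)
  have hM := laplacianGossip_apply G (m + 3)
  have hsurj : ∀ (v : Fin (m + 3) × Fin (j + 2)) (l : Fin (m + 3)), (v, l) ∈ Set.range
      fun p : (Σ _ : Fin (m + 3) × Fin (j + 2), Fin (m + 3)) => (p.1, p.2) :=
    fun v l => ⟨⟨v, l⟩, rfl⟩
  have hquad := inner_toEuclideanLin_eq_sum_dirichlet (Γ := fun _ => G) he hM
  have hcol : ∀ (x : (Σ _ : Fin (m + 3) × Fin (j + 2), Fin (m + 3)) → ℝ) v l,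
      column (fun p => (p.1, p.2)) x l v = x ⟨v, l⟩ := fun x v l => column_apply he x ⟨v, l⟩
  have hentry : ∀ u v : Fin (m + 3) × Fin (j + 2), u ≠ v →
      laplacianGossip G (m + 3) ⟨u, 0⟩ ⟨v, 0⟩ = if G.Adj u v then -1 else 0 := by
    intro u v h
    rw [hM, if_pos rfl, lapMatrix_apply_of_ne _ h]
  have ha : (0 : ℝ) < 1 / (5 * ((m + 3) ^ 2 * (j + 2))) := by positivity
  refine complexity_of_stack (posSemidef_of_lapMatrix (Γ := fun _ => G) he hM)
    (apply_nonpos_of_lapMatrix (Γ := fun _ => G) he hM)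
    -- two nodes of neighbouring cliques whose common neighbour is the hub of the first
    (p := ⟨(0, 1), 0⟩) (q := ⟨(1, 0), 0⟩) (r := ⟨(0, 0), 0⟩) ?_ ?_ ?_
    (stackFullLin _ _) ?_ ?_ (b := 2 * (j + 4 : ℕ)) ha ?_ ?_ ?_ hμ hf hc
  · rw [hentry _ _ (by simp), if_neg]
    rintro (h | h)
    · simp at h
    · simp at h
  · rw [hentry _ _ (by simp), if_pos]
    · norm_num
    · exact Or.inl ⟨rfl, by simp⟩
  · rw [hentry _ _ (by simp), if_pos]
    · norm_num
    · exact Or.inr ⟨rfl, rfl, by rw [SimpleGraph.cycleGraph_adj]; simp⟩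
  · exact fun x => norm_le_stackFull (0, 0) x
  · intro w
    refine toEuclideanLin_eq_zero_of_lapMatrix (Γ := fun _ => G) he hM _ fun l u v _ => ?_
    rw [hcol, hcol]
    rfl
  · intro x
    rw [hquad, norm_sq_eq_sum_column he, Finset.mul_sum]
    exact Finset.sum_le_sum fun l _ => dirichlet_le _ (ringOfCliques_degree_le m j) _
  · intro x
    refine ⟨WithLp.toLp 2 fun l => x ⟨(0, 0), l⟩, ?_⟩
    rw [one_div_mul_eq_div, div_le_iff₀ (by positivity), hquad, EuclideanSpace.real_norm_sq_eq,
      Finset.sum_mul]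
    rw [sum_eq_sum_column he (fun v l => (column (fun p : (Σ _ : Fin (m + 3) × Fin (j + 2),
      Fin (m + 3)) => (p.1, p.2)) x l v - column (fun p : (Σ _ : Fin (m + 3) × Fin (j + 2),
      Fin (m + 3)) => (p.1, p.2)) x l (0, 0)) ^ 2) _ (fun v l h => absurd (hsurj v l) h)]
    · refine Finset.sum_le_sum fun l _ => (ringOfCliques_poincare m j _).trans_eq ?_
      ring
    · intro p
      rw [hcol, hcol]
      rfl
  · rw [Real.sqrt_le_iff]
    refine ⟨by positivity, ?_⟩
    rw [div_le_iff₀ ha]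
    field_simp
    push_cast
    have hj : (0 : ℝ) ≤ j := j.cast_nonneg
    nlinarith

open Classical in
/-- Both methods with the gossip matrix of the crowns of `m + 3` cliques of size `j + 2`.
Every crown contains a star around the node `(l, 0)`, so its spectral gap is bounded below by a constant. -/
theorem complexity_partitionedGossip (m j : ℕ) {L μ : ℝ} (hμ : 0 < μ)
    {f : (i : Fin (m + 3) × Fin (j + 2)) →
      EuclideanSpace ℝ (crownVariables (m + 3) (j + 2) i) → ℝ}
    (hf : ∀ i, LSmooth L (f i)) (hc : ∀ i, StrongConvexOn Set.univ μ (f i)) :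
    ∃ xStar : EuclideanSpace ℝ (Fin (m + 3)),
      IsMinOn (fun x => ∑ i, f i (subvector (crownVariables (m + 3) (j + 2) i) x))
        Set.univ xStar ∧
      MSDAComplexity L μ (partitionedGossip (ringOfCliques (m + 3) (j + 2))
        (crownVariables (m + 3) (j + 2))) f
        (stackPartitioned (crownVariables (m + 3) (j + 2)) xStar)
        (202 * √(L / μ) * (5 * √(j + 2))) ∧
      OPAPCComplexity L μ (partitionedGossip (ringOfCliques (m + 3) (j + 2))
        (crownVariables (m + 3) (j + 2))) f
        (stackPartitioned (crownVariables (m + 3) (j + 2)) xStar)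
        (202 * √(L / μ) * (5 * √(j + 2))) := by
  set G := ringOfCliques (m + 3) (j + 2) with hG
  set N := crownVariables (m + 3) (j + 2) with hN
  have he := partitioned_injective N
  have hM := partitionedGossip_apply G N
  have hquad := inner_toEuclideanLin_eq_sum_dirichlet (Γ := variableGraph G N) he hM
  have hcol : ∀ (x : (Σ i, N i) → ℝ) v l (h : l ∈ N v),
      column (fun p => (p.1, p.2.1)) x l v = x ⟨v, l, h⟩ :=
    fun x v l h => column_apply he x ⟨v, l, h⟩
  have hmem : ∀ v l, l ∈ N v ↔
      v.1 = l ∨ ((v.2 : ℕ) = 0 ∧ (SimpleGraph.cycleGraph (m + 3)).Adj v.1 l) := by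
    intro v l
    simp [hN, crownVariables]
  have hcenter : ∀ l, l ∈ N (l, 0) := fun l => (hmem _ _).2 (Or.inl rfl)
  have hentry : ∀ u v (hu : 0 ∈ N u) (hv : 0 ∈ N v), u ≠ v →
      partitionedGossip G N ⟨u, 0, hu⟩ ⟨v, 0, hv⟩ =
        if (variableGraph G N 0).Adj u v then -1 else 0 := by
    intro u v hu hv h
    rw [hM, if_pos rfl, lapMatrix_apply_of_ne _ h]
  have h01 : (0 : Fin (m + 3)) ∈ N (0, 1) := (hmem _ _).2 (Or.inl rfl)
  have h10 : (0 : Fin (m + 3)) ∈ N (1, 0) :=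
    (hmem _ _).2 (Or.inr ⟨rfl, by rw [SimpleGraph.cycleGraph_adj]; simp⟩)
  refine complexity_of_stack (posSemidef_of_lapMatrix (Γ := variableGraph G N) he hM)
    (apply_nonpos_of_lapMatrix (Γ := variableGraph G N) he hM)
    -- two nodes of the crown of clique `0` whose common neighbour is its hub
    (p := ⟨(0, 1), 0, h01⟩) (q := ⟨(1, 0), 0, h10⟩) (r := ⟨(0, 0), 0, hcenter 0⟩) ?_ ?_ ?_
    (stackPartitionedLin N) ?_ ?_ (b := 2 * (j + 4 : ℕ)) (a := 1 / 2) (by norm_num) ?_ ?_ ?_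
    hμ hf hc
  · rw [hentry _ _ _ _ (by simp), if_neg]
    rintro ⟨h | h, -⟩
    · simp at h
    · simp at h
  · rw [hentry _ _ _ _ (by simp), if_pos]
    · norm_num
    · exact ⟨Or.inl ⟨rfl, by simp⟩, h01, hcenter 0⟩
  · rw [hentry _ _ _ _ (by simp), if_pos]
    · norm_num
    · exact ⟨Or.inr ⟨rfl, rfl, by rw [SimpleGraph.cycleGraph_adj]; simp⟩, hcenter 0, h10⟩
  · exact fun x => norm_le_stackPartitioned hcenter x
  · intro w
    refine toEuclideanLin_eq_zero_of_lapMatrix (Γ := variableGraph G N) he hM _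
      fun l u v h => ?_
    rw [hcol _ _ _ h.2.1, hcol _ _ _ h.2.2]
    rfl
  · intro x
    rw [hquad, norm_sq_eq_sum_column he, Finset.mul_sum]
    refine Finset.sum_le_sum fun l _ => dirichlet_le _ (fun u => ?_) _
    have hle : variableGraph G N l ≤ G := fun _ _ h => h.1
    exact (SimpleGraph.degree_le_of_le hle).trans (ringOfCliques_degree_le m j u)
  · intro x
    refine ⟨WithLp.toLp 2 fun l => x ⟨(l, 0), l, hcenter l⟩, ?_⟩
    rw [one_div_mul_eq_div, div_le_iff₀ two_pos, hquad, EuclideanSpace.real_norm_sq_eq,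
      Finset.sum_mul]
    rw [sum_eq_sum_column he (fun v l => (column (fun p : (Σ i, N i) => (p.1, p.2.1)) x l v -
      column (fun p : (Σ i, N i) => (p.1, p.2.1)) x l (if l ∈ N v then (l, 0) else v)) ^ 2)]
    · refine Finset.sum_le_sum fun l _ => ?_
      refine (sum_sq_sub_le_dirichlet (variableGraph G N l)
        (fun v => if l ∈ N v then (l, 0) else v) (fun v => ?_) _).trans_eq (mul_comm _ _)
      by_cases h : l ∈ N v
      · simp only [h, if_true]
        rcases eq_or_ne (l, 0) v with h1 | h1
        · exact Or.inl h1
        refine Or.inr ⟨?_, h, hcenter l⟩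
        rcases (hmem v l).1 h with h2 | h2
        · exact Or.inl ⟨h2, fun h3 => h1 (Prod.ext h2.symm h3.symm)⟩
        · exact Or.inr ⟨h2.1, rfl, h2.2⟩
      · exact Or.inl (if_neg h)
    · intro v l h
      have : l ∉ N v := fun h' => h ⟨⟨v, l, h'⟩, rfl⟩
      rw [if_neg this, sub_self]
      simp
    · intro p
      rw [if_pos p.2.2]
      rw [hcol _ _ _ p.2.2, hcol _ _ _ (hcenter _)]
      rfl
  · rw [Real.sqrt_le_iff]
    refine ⟨by positivity, ?_⟩
    rw [mul_pow, Real.sq_sqrt (by positivity)]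
    push_cast
    have hj : (0 : ℝ) ≤ j := j.cast_nonneg
    linarith

end Ring

end DistOpt

theorem mainTheorem3 :
    ∃ C : ℝ, 0 < C ∧ ∀ n k : ℕ, 3 ≤ n → 2 ≤ k → ∀ L μ : ℝ, 0 < μ →
      -- every node stores the whole vector of variables, communication matrix `L(G_RC)`
      (∀ f : Fin n × Fin k → EuclideanSpace ℝ (Fin n) → ℝ,
        (∀ i, DistOpt.LSmooth L (f i)) → (∀ i, StrongConvexOn Set.univ μ (f i)) →
        ∃ xStar : EuclideanSpace ℝ (Fin n),
          IsMinOn (fun x => ∑ i, f i x) Set.univ xStar ∧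
          DistOpt.MSDAComplexity L μ (DistOpt.laplacianGossip (DistOpt.ringOfCliques n k) n) f
            (DistOpt.stackFull (Fin n × Fin k) xStar) (C * √(L / μ) * (n * k)) ∧
          DistOpt.OPAPCComplexity L μ (DistOpt.laplacianGossip (DistOpt.ringOfCliques n k) n) f
            (DistOpt.stackFull (Fin n × Fin k) xStar) (C * √(L / μ) * (n * k))) ∧
      -- every node stores only the variables of its function, communication matrix `W`
      (∀ f : (i : Fin n × Fin k) → EuclideanSpace ℝ (DistOpt.crownVariables n k i) → ℝ,
        (∀ i, DistOpt.LSmooth L (f i)) → (∀ i, StrongConvexOn Set.univ μ (f i)) →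
        ∃ xStar : EuclideanSpace ℝ (Fin n),
          IsMinOn (fun x => ∑ i, f i (DistOpt.subvector (DistOpt.crownVariables n k i) x))
            Set.univ xStar ∧
          DistOpt.MSDAComplexity L μ
            (DistOpt.partitionedGossip (DistOpt.ringOfCliques n k) (DistOpt.crownVariables n k)) f
            (DistOpt.stackPartitioned (DistOpt.crownVariables n k) xStar)
            (C * √(L / μ) * √k) ∧
          DistOpt.OPAPCComplexity L μ
            (DistOpt.partitionedGossip (DistOpt.ringOfCliques n k) (DistOpt.crownVariables n k)) f
            (DistOpt.stackPartitioned (DistOpt.crownVariables n k) xStar)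
            (C * √(L / μ) * √k)) := by
  -- `202` rounds per unit of `√χ`, which is at most `5 n k` and `5 √k`
  refine ⟨1010, by norm_num, fun n k hn hk L μ hμ => ?_⟩
  obtain ⟨m, rfl⟩ := Nat.exists_eq_add_of_le' hn
  obtain ⟨j, rfl⟩ := Nat.exists_eq_add_of_le' hk
  constructor
  · intro f hf hc
    have h := DistOpt.complexity_laplacianGossip m j hμ hf hc
    have e : 1010 * √(L / μ) * (((m + 3 : ℕ) : ℝ) * ((j + 2 : ℕ) : ℝ)) =
        202 * √(L / μ) * (5 * ((m + 3) * (j + 2))) := by push_cast; ring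
    rwa [e]
  · intro f hf hc
    have h := DistOpt.complexity_partitionedGossip m j hμ hf hc
    have e : 1010 * √(L / μ) * √((j + 2 : ℕ) : ℝ) = 202 * √(L / μ) * (5 * √(j + 2)) := by
      push_cast; ring
    rwa [e]
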